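/- An ultragraph $\mathcal{G}=(G^0,\mathcal{G}^1,r,s)$ consists of sets $G^0$ (vertices) and $\mathcal{G}^1$ (edges) of arbitrary cardinality, a map $s:\mathcal{G}^1\to G^0$ and a map $r:\mathcal{G}^1\to P(G^0)\setminus\{\emptyset\}$. Let $\mathcal{G}^0$ be the smallest family of subsets of $G^0$ that contains $\emptyset$, all singletons $\{v\}$ and all $r(e)$, and is closed under finite unions and nonempty finite intersections. For a unital commutative ring $R$, the Leavitt path algebra $L_R(\mathcal{G})$ is the universal (not necessarily unital) associative $R$-algebra generated by $\{s_e,s_e^*:e\in\mathcal{G}^1\}\cup\{p_A:A\in\mathcal{G}^0\}$ subject to: (1) $p_\emptyset=0$, $p_Ap_B=p_{A\cap B}$, $p_{A\cup B}=p_A+p_B-p_{A\cap B}$; (2) $p_{s(e)}s_e=s_ep_{r(e)}=s_e$ and $p_{r(e)}s_e^*=s_e^*p_{s(e)}=s_e^*$; (3) $s_e^*s_f=\delta_{e,f}\,p_{r(e)}$; (4) $p_v=\sum_{s(e)=v}s_es_e^*$ whenever $0<|s^{-1}(v)|<\infty$ (here $p_v=p_{\{v\}}$). A cycle is a sequence of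 edges $c=c_1\cdots c_n$, $n\ge 1$, with $s(c_{i+1})\in r(c_i)$ for $1\le i<n$, $s(c_1)\in r(c_n)$, and $s(c_i)\ne s(c_j)$ for $i\neq j$; put $s_c=s_{c_1}\cdots s_{c_n}$ and $c_{n+1}=c_1$. The cycle $c$ is without exit if there are no $i\in\{1,\dots,n\}$ and $e\in\mathcal{G}^1$ with $s(e)\in r(c_i)$ and $e\neq c_{i+1}$, and no $r(c_i)$ contains a sink (a vertex $w$ with $s^{-1}(w)=\emptyset$). Theorem (reduction theorem). Let $\mathcal{G}$ be an arbitrary ultragraph, $R$ a unital commutative ring and $0\neq x\in L_R(\mathcal{G})$. Then there are elements $\mu=\mu_1\cdots\mu_n$ and $\nu=\nu_1\cdots\nu_m$ of $L_R(\mathcal{G})$, with $n,m\ge 1$ and every $\mu_i$ and $\nu_j$ an edge $s_e$, a ghost edge $s_e^*$ ($e\in\mathcal{G}^1$) or a vertex $p_v$ ($v\in G^0$), such that $\mu x\nu\neq 0$ and either $\mu x\nu=\lambda p_A$ for some $\lambda\in R$ and $A\in\mathcal{G}^0$, or $\mu x\nu=\sum_{i=1}^k\lambda_i s_c^i$ for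 some $k\in\mathbb{N}$, $\lambda_1,\dots,\lambda_k\in R$ and some cycle $c$ without exit. -/

import Mathlib

universe u v w z

/-- An ultragraph with vertex set `V` and edge set `E`: each edge has a source vertex and a
nonempty set of vertices as its range. -/
structure Ultragraph (V : Type u) (E : Type v) where
  source : E → V
  range : E → Set V
  range_nonempty : ∀ e, (range e).Nonempty

namespace Ultragraph

variable {V : Type u} {E : Type v}

/-- Membership in `𝒢⁰`, the smallest family of subsets of `V` containing the singletons and the
ranges of edges, and closed under finite unions (the empty one included) and (nonempty) finite
intersections. -/
inductive IsGenVertex (G : Ultragraph V E) : Set V → Prop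
  | empty : IsGenVertex G ∅
  | vertex (v : V) : IsGenVertex G {v}
  | range (e : E) : IsGenVertex G (G.range e)
  | union {A B : Set V} : IsGenVertex G A → IsGenVertex G B → IsGenVertex G (A ∪ B)
  | inter {A B : Set V} : IsGenVertex G A → IsGenVertex G B → IsGenVertex G (A ∩ B)

/-- The set `𝒢⁰` of generalized vertices. -/
def GenVertex (G : Ultragraph V E) : Type u := {A : Set V // G.IsGenVertex A}

namespace GenVertex

variable {G : Ultragraph V E}

def empty (G : Ultragraph V E) : G.GenVertex := ⟨∅, .empty⟩
def vertex (G : Ultragraph V E) (v : V) : G.GenVertex := ⟨{v}, .vertex v⟩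
def range (G : Ultragraph V E) (e : E) : G.GenVertex := ⟨G.range e, .range e⟩
def union (A B : G.GenVertex) : G.GenVertex := ⟨A.1 ∪ B.1, .union A.2 B.2⟩
def inter (A B : G.GenVertex) : G.GenVertex := ⟨A.1 ∩ B.1, .inter A.2 B.2⟩

end GenVertex

/-! ### Paths, cycles and exits -/

/-- A sink is a vertex that emits no edge. -/
def IsSink (G : Ultragraph V E) (v : V) : Prop := ∀ e, G.source e ≠ v

/-- `α` is a path of positive length: `s(α_{i+1}) ∈ r(α_i)` for consecutive edges. -/
def IsPath (G : Ultragraph V E) (α : List E) : Prop :=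
  α ≠ [] ∧ α.IsChain (fun e f => G.source f ∈ G.range e)

/-- A closed path: a path of positive length with `s(α) ∈ r(α)`. -/
def IsClosedPath (G : Ultragraph V E) (α : List E) : Prop :=
  G.IsPath α ∧ ∃ h : α ≠ [], G.source (α.head h) ∈ G.range (α.getLast h)

/-- A cycle: a closed path whose edges have pairwise distinct sources. -/
def IsCycle (G : Ultragraph V E) (α : List E) : Prop :=
  G.IsClosedPath α ∧ (α.map G.source).Nodup

/-- A closed path `α` has an exit if some edge `e ≠ α_{i+1}` has `s(e) ∈ r(α_i)` (indices read
cyclically, so the edge after the last one is the first one), or if some `r(α_i)` contains a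
sink. -/
def HasExit (G : Ultragraph V E) (α : List E) : Prop :=
  (∃ (i : ℕ) (hi : i < α.length) (e : E), G.source e ∈ G.range α[i] ∧
    e ≠ α[(i + 1) % α.length]'(Nat.mod_lt _ (Nat.zero_lt_of_lt hi))) ∨
  ∃ w, G.IsSink w ∧ ∃ f ∈ α, w ∈ G.range f

/-! ### The Leavitt path algebra -/

/-- The generators `p_A`, `s_e`, `s_e^*`. -/
inductive Gen (G : Ultragraph V E) : Type (max u v)
  | p (A : G.GenVertex) : Gen G
  | s (e : E) : Gen G
  | sStar (e : E) : Gen G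

/-- The defining relations of the Leavitt path algebra, in the free unital algebra. -/
inductive Rel (R : Type w) [CommRing R] (G : Ultragraph V E) :
    FreeAlgebra R G.Gen → FreeAlgebra R G.Gen → Prop
  | p_empty : Rel R G (FreeAlgebra.ι R (.p (.empty G))) 0
  | p_mul (A B : G.GenVertex) :
      Rel R G (FreeAlgebra.ι R (.p A) * FreeAlgebra.ι R (.p B)) (FreeAlgebra.ι R (.p (A.inter B)))
  | p_union (A B : G.GenVertex) :
      Rel R G (FreeAlgebra.ι R (.p (A.union B)))
        (FreeAlgebra.ι R (.p A) + FreeAlgebra.ι R (.p B) - FreeAlgebra.ι R (.p (A.inter B)))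
  | source_s (e : E) :
      Rel R G (FreeAlgebra.ι R (.p (.vertex G (G.source e))) * FreeAlgebra.ι R (.s e))
        (FreeAlgebra.ι R (.s e))
  | s_range (e : E) :
      Rel R G (FreeAlgebra.ι R (.s e) * FreeAlgebra.ι R (.p (.range G e)))
        (FreeAlgebra.ι R (.s e))
  | range_sStar (e : E) :
      Rel R G (FreeAlgebra.ι R (.p (.range G e)) * FreeAlgebra.ι R (.sStar e))
        (FreeAlgebra.ι R (.sStar e))
  | sStar_source (e : E) :
      Rel R G (FreeAlgebra.ι R (.sStar e) * FreeAlgebra.ι R (.p (.vertex G (G.source e))))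
        (FreeAlgebra.ι R (.sStar e))
  | sStar_s_self (e : E) :
      Rel R G (FreeAlgebra.ι R (.sStar e) * FreeAlgebra.ι R (.s e))
        (FreeAlgebra.ι R (.p (.range G e)))
  | sStar_s_ne (e f : E) (h : e ≠ f) :
      Rel R G (FreeAlgebra.ι R (.sStar e) * FreeAlgebra.ι R (.s f)) 0
  | sum_source (v : V) (hfin : {e | G.source e = v}.Finite) (hne : ∃ e, G.source e = v) :
      Rel R G (FreeAlgebra.ι R (.p (.vertex G v)))
        (∑ e ∈ hfin.toFinset, FreeAlgebra.ι R (.s e) * FreeAlgebra.ι R (.sStar e))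

/-- The universal *unital* `R`-algebra on the generators and relations of the Leavitt path
algebra. It is only the ambient ring in which `L_R(𝒢)` is realized. -/
abbrev UnitalLPA (R : Type w) [CommRing R] (G : Ultragraph V E) : Type (max u v w) :=
  RingQuot (Rel R G)

/-- The image of a generator in the ambient unital algebra. -/
def UnitalLPA.gen (R : Type w) [CommRing R] (G : Ultragraph V E) (g : G.Gen) : UnitalLPA R G :=
  RingQuot.mkAlgHom R (Rel R G) (FreeAlgebra.ι R g)

/-- The product `s_c = s_{c_1} ⋯ s_{c_n}` of the edges of a path. -/
def UnitalLPA.path (R : Type w) [CommRing R] (G : Ultragraph V E) (c : List E) : UnitalLPA R G :=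
  (c.map fun e => UnitalLPA.gen R G (.s e)).prod

/-- The Leavitt path algebra `L_R(𝒢)`: the (not necessarily unital) `R`-algebra generated by the
`p_A`, `s_e`, `s_e^*`. That it is the universal (not necessarily unital) `R`-algebra on these
generators and the defining relations is proved in `LPA.isLeavittFamily` and
`LPA.existsUnique_hom` below. -/
abbrev LPA (R : Type w) [CommRing R] (G : Ultragraph V E) : Type (max u v w) :=
  NonUnitalAlgebra.adjoin R (Set.range (UnitalLPA.gen R G))

namespace LPA

/-- A generator as an element of `L_R(𝒢)`. -/
def gen (R : Type w) [CommRing R] (G : Ultragraph V E) (g : G.Gen) : LPA R G :=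
  ⟨UnitalLPA.gen R G g, NonUnitalAlgebra.subset_adjoin R (Set.mem_range_self g)⟩

def p (R : Type w) [CommRing R] (G : Ultragraph V E) (A : G.GenVertex) : LPA R G :=
  gen R G (.p A)
def s (R : Type w) [CommRing R] (G : Ultragraph V E) (e : E) : LPA R G :=
  gen R G (.s e)
def sStar (R : Type w) [CommRing R] (G : Ultragraph V E) (e : E) : LPA R G :=
  gen R G (.sStar e)

/-- The elements `μ_1 ⋯ μ_n` (`n ≥ 1`) of `L_R(𝒢)` where every `μ_i` is an edge `s_e`, a ghost
edge `s_e^*` or a vertex `p_v`. -/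
def words (R : Type w) [CommRing R] (G : Ultragraph V E) : Subsemigroup (LPA R G) :=
  Subsemigroup.closure
    (Set.range (s R G) ∪ Set.range (sStar R G) ∪ Set.range (fun v => p R G (.vertex G v)))

/-! ### The universal property -/

/-- A family in a not necessarily unital ring that satisfies the defining relations. -/
structure IsLeavittFamily (G : Ultragraph V E) {B : Type z} [NonUnitalRing B]
    (P : G.GenVertex → B) (S T : E → B) : Prop where
  p_empty : P (.empty G) = 0
  p_mul : ∀ A C, P A * P C = P (A.inter C)
  p_union : ∀ A C : G.GenVertex, P (A.union C) = P A + P C - P (A.inter C)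
  source_s : ∀ e, P (.vertex G (G.source e)) * S e = S e
  s_range : ∀ e, S e * P (.range G e) = S e
  range_sStar : ∀ e, P (.range G e) * T e = T e
  sStar_source : ∀ e, T e * P (.vertex G (G.source e)) = T e
  sStar_s_self : ∀ e, T e * S e = P (.range G e)
  sStar_s_ne : ∀ e f, e ≠ f → T e * S f = 0
  sum_source : ∀ (v : V) (hfin : {e | G.source e = v}.Finite), (∃ e, G.source e = v) →
    P (.vertex G v) = ∑ e ∈ hfin.toFinset, S e * T e

theorem isLeavittFamily (R : Type w) [CommRing R] (G : Ultragraph V E) :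
    IsLeavittFamily G (p R G) (s R G) (sStar R G) := by
  have key : ∀ {a b : FreeAlgebra R G.Gen}, Rel R G a b →
      RingQuot.mkAlgHom R (Rel R G) a = RingQuot.mkAlgHom R (Rel R G) b :=
    fun h => RingQuot.mkAlgHom_rel R h
  constructor
  · exact Subtype.ext (by simpa [p, s, sStar, gen, UnitalLPA.gen] using key .p_empty)
  · intro A C; exact Subtype.ext (by simpa [p, s, sStar, gen, UnitalLPA.gen] using key (.p_mul A C))
  · intro A C; exact Subtype.ext (by simpa [p, s, sStar, gen, UnitalLPA.gen] using key (.p_union A C))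
  · intro e; exact Subtype.ext (by simpa [p, s, sStar, gen, UnitalLPA.gen] using key (.source_s e))
  · intro e; exact Subtype.ext (by simpa [p, s, sStar, gen, UnitalLPA.gen] using key (.s_range e))
  · intro e; exact Subtype.ext (by simpa [p, s, sStar, gen, UnitalLPA.gen] using key (.range_sStar e))
  · intro e; exact Subtype.ext (by simpa [p, s, sStar, gen, UnitalLPA.gen] using key (.sStar_source e))
  · intro e; exact Subtype.ext (by simpa [p, s, sStar, gen, UnitalLPA.gen] using key (.sStar_s_self e))
  · intro e f h; exact Subtype.ext (by simpa [p, s, sStar, gen, UnitalLPA.gen] using key (.sStar_s_ne e f h))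
  · intro v hfin hne
    refine Subtype.ext ?_
    have h := key (.sum_source v hfin hne)
    rw [map_sum] at h
    rw [AddSubmonoidClass.coe_finsetSum]
    simpa [p, s, sStar, gen, UnitalLPA.gen] using h

theorem existsUnique_hom (R : Type w) [CommRing R] (G : Ultragraph V E) {B : Type z}
    [NonUnitalRing B] [Module R B] [IsScalarTower R B B] [SMulCommClass R B B]
    (P : G.GenVertex → B) (S T : E → B) (h : IsLeavittFamily G P S T) :
    ∃! φ : LPA R G →ₙₐ[R] B,
      (∀ A, φ (p R G A) = P A) ∧ (∀ e, φ (s R G e) = S e) ∧ ∀ e, φ (sStar R G e) = T e := by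
  let g : G.Gen → B := fun x => match x with
    | .p A => P A
    | .s e => S e
    | .sStar e => T e
  let F : FreeAlgebra R G.Gen →ₐ[R] Unitization R B :=
    FreeAlgebra.lift R fun x => (g x : Unitization R B)
  have hF : ∀ x, F (FreeAlgebra.ι R x) = (g x : Unitization R B) := fun x => by simp [F]
  have hrel : ∀ ⦃a b⦄, Rel R G a b → F a = F b := by
    intro a b hab
    induction hab with
    | p_empty => simp [hF, g, h.p_empty]
    | p_mul A C => simp [hF, g, ← Unitization.inr_mul, h.p_mul]
    | p_union A C =>
      simp [hF, g, ← Unitization.inr_add, ← Unitization.inr_sub, h.p_union]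
    | source_s e => simp [hF, g, ← Unitization.inr_mul, h.source_s]
    | s_range e => simp [hF, g, ← Unitization.inr_mul, h.s_range]
    | range_sStar e => simp [hF, g, ← Unitization.inr_mul, h.range_sStar]
    | sStar_source e => simp [hF, g, ← Unitization.inr_mul, h.sStar_source]
    | sStar_s_self e => simp [hF, g, ← Unitization.inr_mul, h.sStar_s_self]
    | sStar_s_ne e f hef => simp [hF, g, ← Unitization.inr_mul, h.sStar_s_ne e f hef]
    | sum_source v hfin hne =>
      simp only [hF, g, map_sum, map_mul, ← Unitization.inr_mul, h.sum_source v hfin hne]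
      exact map_sum (Unitization.inrNonUnitalAlgHom R B) _ _
  let Φ : UnitalLPA R G →ₐ[R] Unitization R B := RingQuot.liftAlgHom R ⟨F, hrel⟩
  have hΦ : ∀ x, Φ (UnitalLPA.gen R G x) = (g x : Unitization R B) := fun x => by
    simp [Φ, UnitalLPA.gen, hF]
  have hfst : ∀ x : LPA R G, (Φ x).fst = 0 := by
    rintro ⟨x, hx⟩
    induction hx using NonUnitalAlgebra.adjoin_induction with
    | mem x hx => obtain ⟨y, rfl⟩ := hx; simp [hΦ]
    | add x y _ _ hx hy => simp_all
    | zero => simp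
    | mul x y _ _ hx hy => simp_all
    | smul r x _ hx => simp_all
  refine ⟨
    { toFun := fun x => (Φ x).snd
      map_smul' := fun r x => by simp
      map_zero' := by simp
      map_add' := fun x y => by simp
      map_mul' := fun x y => by simp [hfst] }, ⟨?_, ?_, ?_⟩, ?_⟩
  · intro A
    exact (congrArg (fun z : Unitization R B => z.snd) (hΦ (.p A))).trans rfl
  · intro e
    exact (congrArg (fun z : Unitization R B => z.snd) (hΦ (.s e))).trans rfl
  · intro e
    exact (congrArg (fun z : Unitization R B => z.snd) (hΦ (.sStar e))).trans rfl
  · rintro ψ ⟨h1, h2, h3⟩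
    ext ⟨x, hx⟩
    have hgen : ∀ y, ψ (gen R G y) = g y := by
      rintro (A | e | e)
      exacts [h1 A, h2 e, h3 e]
    induction hx using NonUnitalAlgebra.adjoin_induction with
    | mem x hx =>
      obtain ⟨y, rfl⟩ := hx
      exact (hgen y).trans (congrArg (fun z : Unitization R B => z.snd) (hΦ y)).symm
    | add x y hx hy ihx ihy =>
      have := map_add ψ ⟨x, hx⟩ ⟨y, hy⟩
      refine this.trans ?_
      rw [ihx, ihy, ← map_add]; rfl
    | zero => exact (map_zero ψ).trans (map_zero _).symm
    | mul x y hx hy ihx ihy =>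
      have := map_mul ψ ⟨x, hx⟩ ⟨y, hy⟩
      refine this.trans ?_
      rw [ihx, ihy, ← map_mul]; rfl
    | smul r x hx ihx =>
      have := map_smul ψ r ⟨x, hx⟩
      refine this.trans ?_
      rw [ihx, ← map_smul]; rfl

end LPA

end Ultragraph

/-!
The argument takes place in an arbitrary `R`-algebra `B` with a Leavitt family `P, S, T`; it uses
one fact that depends on the algebra, `VertexIndependent`: for `r ≠ 0` the element `r p_v` is not a
combination of elements `s_α p_A` with `α` of positive length. For the universal algebra it is
read off from a representation on functions on (maximal path, integer) pairs, in which `s_e` shifts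
the integer by one (`UnitalLPA.vertexIndependent`).

Every element is a combination of monomials `s_α p_A s_β^*`. Given `x ≠ 0`, multiplying by edges on
the right removes ghost edges. This gets stuck only when `x s_e = 0` for all `e`, and then `x`
has no ghost edges anyway (`mem_pathSpan_of_mul_s_eq_zero`). An element without ghost edges is
determined by its products with the `p_v` (`eq_zero_of_mul_vertex`), and stripping a shortest path
from its left leaves `r p_v + ∑ t_i s_{β_i} p_v`, with `r ≠ 0` and all `β_i` of positive length
(`exists_word_mul_eq`). Such an element is never zero, whatever the `t_i` and `β_i`.

Among all elements of this shape of the form `μ x ν`, at all vertices `v`, take one with the least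
number of terms. Multiplying on both sides by `p_v`, or by `p_w s_e^*` and `s_e p_w` with
`s(e) = v` and `w ∈ r(e)`, gives another such element, so by minimality it kills no term. If there
are terms, this says that every `β_i` is a closed path at `v`, that `v` emits exactly one edge `e`,
that `r(e) = {w}`, and that `w` is again a vertex of a minimal element
(`ReducesTo.exists_unique_edge`). Hence the trajectory of `v` is forced, it runs around a cycle
`c` without exit, and every `β_i` is a power of `c`. A final factor `s_c` turns the constant term
into a multiple of `s_c`. If there are no terms, the minimal element is `r p_v`.
-/

namespace Ultragraph

variable {V : Type u} {E : Type v}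

/-! ### Generalized vertices as sets -/

namespace GenVertex

variable {G : Ultragraph V E}

/-- The underlying set of vertices of a generalized vertex. -/
def toSet (A : G.GenVertex) : Set V := A.1

theorem ext {A B : G.GenVertex} (h : ∀ v, v ∈ A.toSet ↔ v ∈ B.toSet) : A = B :=
  Subtype.ext (Set.ext h)

@[simp] theorem mem_empty (v : V) : v ∈ (empty G).toSet ↔ False := Iff.rfl

@[simp] theorem mem_vertex (v w : V) : w ∈ (vertex G v).toSet ↔ w = v := Iff.rfl

@[simp] theorem mem_range (e : E) (w : V) : w ∈ (range G e).toSet ↔ w ∈ G.range e := Iff.rfl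

@[simp] theorem mem_union (A B : G.GenVertex) (v : V) :
    v ∈ (A.union B).toSet ↔ v ∈ A.toSet ∨ v ∈ B.toSet := Iff.rfl

@[simp] theorem mem_inter (A B : G.GenVertex) (v : V) :
    v ∈ (A.inter B).toSet ↔ v ∈ A.toSet ∧ v ∈ B.toSet := Iff.rfl

end GenVertex

/-! ### A representation on maximal paths -/

/-- A maximal path of `G`, encoded as a sequence of vertices together with the edge, if any, by
which the path leaves the vertex. A path may stop only at a sink; the entries of the sequence
after that are irrelevant. -/
def MaxPath (G : Ultragraph V E) : Type (max u v) :=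
  {x : ℕ → V × Option E //
    ∀ n, (∀ e, (x n).2 = some e → G.source e = (x n).1 ∧ (x (n + 1)).1 ∈ G.range e) ∧
      ((x n).2 = none → G.IsSink (x n).1)}

namespace MaxPath

variable {G : Ultragraph V E}

/-- The first vertex of a maximal path. -/
def start (x : G.MaxPath) : V := (x.1 0).1

/-- The first edge of a maximal path, if there is one. -/
def edge (x : G.MaxPath) : Option E := (x.1 0).2

/-- The maximal path without its first edge. -/
def shift (x : G.MaxPath) : G.MaxPath := ⟨fun n => x.1 (n + 1), fun n => x.2 (n + 1)⟩

/-- The maximal path `x` preceded by the edge `e`. -/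
def cons (e : E) (x : G.MaxPath) (hx : x.start ∈ G.range e) : G.MaxPath :=
  ⟨fun n => Nat.casesOn n (G.source e, some e) x.1, fun n => by
    cases n with
    | zero => exact ⟨by rintro _ ⟨⟩; exact ⟨rfl, hx⟩, by simp⟩
    | succ n => exact x.2 n⟩

theorem start_of_edge {x : G.MaxPath} {e : E} (h : x.edge = some e) : x.start = G.source e :=
  ((x.2 0).1 e h).1.symm

theorem start_shift_mem {x : G.MaxPath} {e : E} (h : x.edge = some e) :
    x.shift.start ∈ G.range e :=
  ((x.2 0).1 e h).2

theorem cons_shift {x : G.MaxPath} {e : E} (h : x.edge = some e) :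
    cons e x.shift (start_shift_mem h) = x := by
  refine Subtype.ext (funext fun n => ?_)
  cases n with
  | zero => exact Prod.ext (start_of_edge h).symm h.symm
  | succ n => rfl

theorem exists_start_eq (G : Ultragraph V E) (v : V) : ∃ x : G.MaxPath, x.start = v := by
  classical
  have step : ∀ v : V, ∃ q : Option E × V,
      (∀ e, q.1 = some e → G.source e = v ∧ q.2 ∈ G.range e) ∧ (q.1 = none → G.IsSink v) := by
    intro v
    by_cases h : G.IsSink v
    · exact ⟨(none, v), by simp, fun _ => h⟩
    · simp only [IsSink, not_forall, not_not] at h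
      obtain ⟨e, he⟩ := h
      obtain ⟨w, hw⟩ := G.range_nonempty e
      refine ⟨(some e, w), ?_, by simp⟩
      rintro _ ⟨⟩
      exact ⟨he, hw⟩
  choose q hq using step
  refine ⟨⟨fun n => ((fun u => (q u).2)^[n] v, (q ((fun u => (q u).2)^[n] v)).1), fun n => ?_⟩, rfl⟩
  simp only [Function.iterate_succ_apply']
  exact hq _

end MaxPath

open Classical in
/-- The action of a generator on `R`-valued functions on maximal paths with an integer degree:
`p_A` restricts to the paths starting in `A`, and `s_e` transports a function along `x ↦ e x`,
raising the degree by one. -/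
noncomputable def genAction (R : Type w) [CommRing R] (G : Ultragraph V E) :
    G.Gen → Module.End R (G.MaxPath × ℤ → R)
  | .p A =>
    { toFun := fun f x => if x.1.start ∈ A.toSet then f x else 0
      map_add' := fun f g => by ext x; by_cases h : x.1.start ∈ A.toSet <;> simp [h]
      map_smul' := fun r f => by ext x; by_cases h : x.1.start ∈ A.toSet <;> simp [h] }
  | .s e =>
    { toFun := fun f x => if x.1.edge = some e then f (x.1.shift, x.2 - 1) else 0
      map_add' := fun f g => by ext x; by_cases h : x.1.edge = some e <;> simp [h]
      map_smul' := fun r f => by ext x; by_cases h : x.1.edge = some e <;> simp [h] }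
  | .sStar e =>
    { toFun := fun f x =>
        if h : x.1.start ∈ G.range e then f (x.1.cons e h, x.2 + 1) else 0
      map_add' := fun f g => by ext x; by_cases h : x.1.start ∈ G.range e <;> simp [h]
      map_smul' := fun r f => by ext x; by_cases h : x.1.start ∈ G.range e <;> simp [h] }

section genAction

variable (R : Type w) [CommRing R] (G : Ultragraph V E)

open Classical in
theorem genAction_p (A : G.GenVertex) (f : G.MaxPath × ℤ → R) (x : G.MaxPath × ℤ) :
    genAction R G (.p A) f x = if x.1.start ∈ A.toSet then f x else 0 := rfl

open Classical in
theorem genAction_s (e : E) (f : G.MaxPath × ℤ → R) (x : G.MaxPath × ℤ) :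
    genAction R G (.s e) f x = if x.1.edge = some e then f (x.1.shift, x.2 - 1) else 0 := rfl

open Classical in
theorem genAction_sStar (e : E) (f : G.MaxPath × ℤ → R) (x : G.MaxPath × ℤ) :
    genAction R G (.sStar e) f x =
      if h : x.1.start ∈ G.range e then f (x.1.cons e h, x.2 + 1) else 0 := rfl

theorem genAction_s_sStar (e : E) (f : G.MaxPath × ℤ → R) (x : G.MaxPath × ℤ) :
    genAction R G (.s e) (genAction R G (.sStar e) f) x =
      open Classical in if x.1.edge = some e then f x else 0 := by
  rw [genAction_s, genAction_sStar]
  split_ifs with h h'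
  · simp [MaxPath.cons_shift h]
  · exact absurd (MaxPath.start_shift_mem h) h'
  · rfl

theorem genAction_sStar_s (e e' : E) (f : G.MaxPath × ℤ → R) (x : G.MaxPath × ℤ) :
    genAction R G (.sStar e) (genAction R G (.s e') f) x =
      open Classical in if x.1.start ∈ G.range e ∧ e = e' then f x else 0 := by
  rw [genAction_sStar]
  split_ifs with h h' h'
  · obtain ⟨-, rfl⟩ := h'
    refine (if_pos rfl).trans ?_
    exact congrArg f (Prod.ext rfl (add_sub_cancel_right _ _))
  · rw [genAction_s, if_neg]
    intro h1
    exact h' ⟨h, Option.some.inj h1⟩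
  · exact absurd h'.1 h
  · rfl

theorem genAction_rel {a b : FreeAlgebra R G.Gen} (h : Rel R G a b) :
    FreeAlgebra.lift R (genAction R G) a = FreeAlgebra.lift R (genAction R G) b := by
  classical
  induction h with
  | p_empty =>
    ext f x
    simp [genAction_p]
  | p_mul A C =>
    ext f x
    simp only [map_mul, FreeAlgebra.lift_ι_apply, Module.End.mul_apply, genAction_p,
      GenVertex.mem_inter]
    split_ifs <;> simp_all
  | p_union A C =>
    refine LinearMap.ext fun f => funext fun x => ?_
    simp only [map_add, map_sub, FreeAlgebra.lift_ι_apply, LinearMap.add_apply,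
      LinearMap.sub_apply, Pi.add_apply, Pi.sub_apply, genAction_p,
      GenVertex.mem_inter, GenVertex.mem_union]
    split_ifs <;> simp_all
  | source_s e =>
    refine LinearMap.ext fun f => funext fun x => ?_
    simp only [map_mul, FreeAlgebra.lift_ι_apply, Module.End.mul_apply, genAction_p, genAction_s,
      GenVertex.mem_vertex]
    split_ifs with h h' h'
    · rfl
    · rfl
    · exact absurd (MaxPath.start_of_edge h') h
    · rfl
  | s_range e =>
    refine LinearMap.ext fun f => funext fun x => ?_
    simp only [map_mul, FreeAlgebra.lift_ι_apply, Module.End.mul_apply, genAction_p, genAction_s,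
      GenVertex.mem_range]
    split_ifs with h h'
    · rfl
    · exact absurd (MaxPath.start_shift_mem h) h'
    · rfl
  | range_sStar e =>
    refine LinearMap.ext fun f => funext fun x => ?_
    simp only [map_mul, FreeAlgebra.lift_ι_apply, Module.End.mul_apply, genAction_p,
      genAction_sStar, GenVertex.mem_range]
    split_ifs <;> rfl
  | sStar_source e =>
    refine LinearMap.ext fun f => funext fun x => ?_
    simp only [map_mul, FreeAlgebra.lift_ι_apply, Module.End.mul_apply, genAction_p,
      genAction_sStar, GenVertex.mem_vertex]
    split_ifs with h h'
    · rfl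
    · exact absurd rfl h'
    · rfl
  | sStar_s_self e =>
    refine LinearMap.ext fun f => funext fun x => ?_
    simp only [map_mul, FreeAlgebra.lift_ι_apply, Module.End.mul_apply, genAction_p,
      genAction_sStar_s, GenVertex.mem_range, and_true]
  | sStar_s_ne e e' hne =>
    refine LinearMap.ext fun f => funext fun x => ?_
    simp only [map_mul, FreeAlgebra.lift_ι_apply, Module.End.mul_apply,
      genAction_sStar_s, hne, and_false, if_false, map_zero]
    rfl
  | sum_source v hfin hne =>
    refine LinearMap.ext fun f => funext fun x => ?_
    simp only [map_sum, map_mul, FreeAlgebra.lift_ι_apply, LinearMap.sum_apply, Finset.sum_apply,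
      Module.End.mul_apply, genAction_s_sStar, genAction_p, GenVertex.mem_vertex]
    split_ifs with h
    · cases he : x.1.edge with
      | none =>
        obtain ⟨e, hev⟩ := hne
        exact absurd (hev.trans h.symm) ((x.1.2 0).2 he e)
      | some e =>
        have hmem : e ∈ hfin.toFinset := by
          simpa using (MaxPath.start_of_edge he).symm.trans h
        have hv : G.source e = v := by simpa using hmem
        simp [hv]
    · refine (Finset.sum_eq_zero fun e he => if_neg fun h' => h ?_).symm
      rw [MaxPath.start_of_edge h']
      simpa using he

/-- The representation of the Leavitt path algebra on functions on maximal paths. -/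
noncomputable def pathRep : UnitalLPA R G →ₐ[R] Module.End R (G.MaxPath × ℤ → R) :=
  RingQuot.liftAlgHom R ⟨FreeAlgebra.lift R (genAction R G), fun _ _ h => genAction_rel R G h⟩

theorem pathRep_gen (g : G.Gen) : pathRep R G (UnitalLPA.gen R G g) = genAction R G g := by
  simp [pathRep, UnitalLPA.gen]

/-- The representation is graded: the operator of `s_α p_A` shifts degrees by the length of
`α`. -/
theorem pathRep_path_mul_p_apply (α : List E) (A : G.GenVertex) (f : G.MaxPath × ℤ → R)
    (hf : ∀ x n, n ≠ 0 → f (x, n) = 0) (x : G.MaxPath) (n : ℤ) (hn : n ≠ α.length) :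
    pathRep R G ((α.map fun e => UnitalLPA.gen R G (.s e)).prod * UnitalLPA.gen R G (.p A))
      f (x, n) = 0 := by
  induction α generalizing x n with
  | nil =>
    rw [List.map_nil, List.prod_nil, one_mul, pathRep_gen, genAction_p, hf x n (by simpa using hn),
      ite_self]
  | cons e α ih =>
    rw [List.map_cons, List.prod_cons, mul_assoc, map_mul, Module.End.mul_apply, pathRep_gen,
      genAction_s, ih, ite_self]
    rw [List.length_cons] at hn
    push_cast at hn
    omega

end genAction
/-! ### Spans of monomials and words -/

section Spans

variable {G : Ultragraph V E} (R : Type w) [CommRing R] {B : Type z} [Ring B] [Algebra R B]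
  (P : G.GenVertex → B) (S T : E → B)

/-- The span of the elements `s_α p_A` with `α` in a given set of words in the edges. -/
def pathSpan (C : Set (List E)) : Submodule R B :=
  Submodule.span R {x | ∃ α ∈ C, ∃ A, x = (α.map S).prod * P A}

/-- The span of the elements `s_α p_A s_β^*` with `β` in a given set of words in the edges. -/
def monomialSpan (C : Set (List E)) : Submodule R B :=
  Submodule.span R {x | ∃ α : List E, ∃ A, ∃ β ∈ C, x = (α.map S).prod * P A * ((β.map T).reverse).prod}

/-- For `r ≠ 0` the element `r p_v` does not lie in the span of the `s_α p_A` with `α` of positive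
length; in particular it is not zero. -/
def VertexIndependent : Prop :=
  ∀ (v : V) (r : R), r • P (.vertex G v) ∈ pathSpan R P S {α | α ≠ []} → r = 0

/-- The products of length at least one of edges, ghost edges and vertices. -/
def wordsOf : Subsemigroup B :=
  Subsemigroup.closure (Set.range S ∪ Set.range T ∪ Set.range fun v => P (.vertex G v))

variable {R P S T}

theorem edge_mem_wordsOf (e : E) : S e ∈ wordsOf P S T :=
  Subsemigroup.subset_closure (.inl (.inl ⟨e, rfl⟩))

theorem ghost_mem_wordsOf (e : E) : T e ∈ wordsOf P S T :=
  Subsemigroup.subset_closure (.inl (.inr ⟨e, rfl⟩))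

theorem vertex_mem_wordsOf (v : V) : P (.vertex G v) ∈ wordsOf P S T :=
  Subsemigroup.subset_closure (.inr ⟨v, rfl⟩)

theorem path_mem_wordsOf {α : List E} (hα : α ≠ []) : (α.map S).prod ∈ wordsOf P S T := by
  induction α with
  | nil => exact absurd rfl hα
  | cons e α ih =>
    rw [List.map_cons, List.prod_cons]
    by_cases h : α = []
    · simpa [h] using edge_mem_wordsOf e
    · exact mul_mem (edge_mem_wordsOf e) (ih h)

theorem mem_pathSpan {C : Set (List E)} {α : List E} (hα : α ∈ C) (A : G.GenVertex) :
    (α.map S).prod * P A ∈ pathSpan R P S C :=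
  Submodule.subset_span ⟨α, hα, A, rfl⟩

theorem mem_monomialSpan {C : Set (List E)} (α : List E) (A : G.GenVertex) {β : List E}
    (hβ : β ∈ C) :
    (α.map S).prod * P A * ((β.map T).reverse).prod ∈ monomialSpan R P S T C :=
  Submodule.subset_span ⟨α, A, β, hβ, rfl⟩

theorem map_mem_of_mem_pathSpan {C : Set (List E)} (N : Submodule R B) (f : B →ₗ[R] B)
    (h : ∀ α ∈ C, ∀ A, f ((α.map S).prod * P A) ∈ N) {x : B} (hx : x ∈ pathSpan R P S C) :
    f x ∈ N := by
  have : pathSpan R P S C ≤ N.comap f :=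
    Submodule.span_le.2 (by rintro _ ⟨α, hα, A, rfl⟩; exact h α hα A)
  exact this hx

theorem map_mem_of_mem_monomialSpan {C : Set (List E)} (N : Submodule R B) (f : B →ₗ[R] B)
    (h : ∀ α : List E, ∀ A, ∀ β ∈ C, f ((α.map S).prod * P A * ((β.map T).reverse).prod) ∈ N)
    {x : B} (hx : x ∈ monomialSpan R P S T C) : f x ∈ N := by
  have : monomialSpan R P S T C ≤ N.comap f :=
    Submodule.span_le.2 (by rintro _ ⟨α, A, β, hβ, rfl⟩; exact h α A β hβ)
  exact this hx

theorem pathSpan_mono {C D : Set (List E)} (h : C ⊆ D) : pathSpan R P S C ≤ pathSpan R P S D :=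
  Submodule.span_mono (by rintro _ ⟨α, hα, A, rfl⟩; exact ⟨α, h hα, A, rfl⟩)

theorem monomialSpan_mono {C D : Set (List E)} (h : C ⊆ D) :
    monomialSpan R P S T C ≤ monomialSpan R P S T D :=
  Submodule.span_mono (by rintro _ ⟨α, A, β, hβ, rfl⟩; exact ⟨α, A, β, h hβ, rfl⟩)

theorem exists_mem_pathSpan_length_le {C : Set (List E)} {x : B} (hx : x ∈ pathSpan R P S C) :
    ∃ n, x ∈ pathSpan R P S {α | α.length ≤ n} := by
  induction hx using Submodule.span_induction with
  | mem x h =>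
    obtain ⟨α, -, A, rfl⟩ := h
    exact ⟨α.length, mem_pathSpan (C := {β | β.length ≤ α.length}) (Set.mem_ofPred.2 le_rfl) A⟩
  | zero => exact ⟨0, zero_mem _⟩
  | add x y _ _ hx hy =>
    obtain ⟨n, hn⟩ := hx
    obtain ⟨m, hm⟩ := hy
    refine ⟨max n m, add_mem (pathSpan_mono ?_ hn) (pathSpan_mono ?_ hm)⟩
    · exact Set.ofPred_subset_ofPred.2 fun _ h => h.trans (le_max_left n m)
    · exact Set.ofPred_subset_ofPred.2 fun _ h => h.trans (le_max_right n m)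
  | smul r x _ hx =>
    obtain ⟨n, hn⟩ := hx
    exact ⟨n, Submodule.smul_mem _ r hn⟩

theorem exists_mem_monomialSpan_length_le {C : Set (List E)} {x : B}
    (hx : x ∈ monomialSpan R P S T C) : ∃ n, x ∈ monomialSpan R P S T {α | α.length ≤ n} := by
  induction hx using Submodule.span_induction with
  | mem x h =>
    obtain ⟨α, A, β, -, rfl⟩ := h
    exact ⟨β.length, mem_monomialSpan (C := {γ | γ.length ≤ β.length}) α A (Set.mem_ofPred.2 le_rfl)⟩
  | zero => exact ⟨0, zero_mem _⟩
  | add x y _ _ hx hy =>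
    obtain ⟨n, hn⟩ := hx
    obtain ⟨m, hm⟩ := hy
    refine ⟨max n m, add_mem (monomialSpan_mono ?_ hn) (monomialSpan_mono ?_ hm)⟩
    · exact Set.ofPred_subset_ofPred.2 fun _ h => h.trans (le_max_left n m)
    · exact Set.ofPred_subset_ofPred.2 fun _ h => h.trans (le_max_right n m)
  | smul r x _ hx =>
    obtain ⟨n, hn⟩ := hx
    exact ⟨n, Submodule.smul_mem _ r hn⟩

end Spans

namespace LPA.IsLeavittFamily

variable {G : Ultragraph V E} {R : Type w} [CommRing R] {B : Type z} [Ring B] [Algebra R B]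
  {P : G.GenVertex → B} {S T : E → B}

/-! ### Multiplication rules -/

theorem p_comm (h : IsLeavittFamily G P S T) (A C : G.GenVertex) : P A * P C = P C * P A := by
  rw [h.p_mul, h.p_mul]
  exact congrArg P (GenVertex.ext fun v => by simp [and_comm])

theorem p_mul_self (h : IsLeavittFamily G P S T) (A : G.GenVertex) : P A * P A = P A := by
  rw [h.p_mul]
  exact congrArg P (GenVertex.ext fun v => by simp)

theorem p_mul_vertex (h : IsLeavittFamily G P S T) {A : G.GenVertex} {v : V} (hv : v ∈ A.toSet) :
    P A * P (.vertex G v) = P (.vertex G v) := by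
  rw [h.p_mul]
  refine congrArg P (GenVertex.ext fun w => ?_)
  simp only [GenVertex.mem_inter, GenVertex.mem_vertex, and_iff_right_iff_imp]
  rintro rfl
  exact hv

theorem p_mul_vertex_of_notMem (h : IsLeavittFamily G P S T) {A : G.GenVertex} {v : V}
    (hv : v ∉ A.toSet) : P A * P (.vertex G v) = 0 := by
  rw [h.p_mul, ← h.p_empty]
  refine congrArg P (GenVertex.ext fun w => ?_)
  simp only [GenVertex.mem_inter, GenVertex.mem_vertex, GenVertex.mem_empty, iff_false]
  rintro ⟨hw, rfl⟩
  exact hv hw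

theorem vertex_mul_p (h : IsLeavittFamily G P S T) {A : G.GenVertex} {v : V} (hv : v ∈ A.toSet) :
    P (.vertex G v) * P A = P (.vertex G v) := by
  rw [h.p_comm, h.p_mul_vertex hv]

theorem p_mul_s (h : IsLeavittFamily G P S T) {A : G.GenVertex} {e : E}
    (he : G.source e ∈ A.toSet) : P A * S e = S e := by
  rw [← h.source_s e, ← mul_assoc, h.p_mul_vertex he]

theorem p_mul_s_of_notMem (h : IsLeavittFamily G P S T) {A : G.GenVertex} {e : E}
    (he : G.source e ∉ A.toSet) : P A * S e = 0 := by
  rw [← h.source_s e, ← mul_assoc, h.p_mul_vertex_of_notMem he, zero_mul]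

theorem sStar_mul_p (h : IsLeavittFamily G P S T) {A : G.GenVertex} {e : E}
    (he : G.source e ∈ A.toSet) : T e * P A = T e := by
  rw [← h.sStar_source e, mul_assoc, h.vertex_mul_p he]

theorem sStar_mul_p_of_notMem (h : IsLeavittFamily G P S T) {A : G.GenVertex} {e : E}
    (he : G.source e ∉ A.toSet) : T e * P A = 0 := by
  rw [← h.sStar_source e, mul_assoc, h.p_comm, h.p_mul_vertex_of_notMem he, mul_zero]

theorem p_mul_path (h : IsLeavittFamily G P S T) {A : G.GenVertex} {e : E} (α : List E)
    (he : G.source e ∈ A.toSet) :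
    P A * ((e :: α).map S).prod = ((e :: α).map S).prod := by
  rw [List.map_cons, List.prod_cons, ← mul_assoc, h.p_mul_s he]

theorem p_mul_path_of_notMem (h : IsLeavittFamily G P S T) {A : G.GenVertex} {e : E} (α : List E)
    (he : G.source e ∉ A.toSet) : P A * ((e :: α).map S).prod = 0 := by
  rw [List.map_cons, List.prod_cons, ← mul_assoc, h.p_mul_s_of_notMem he, zero_mul]

theorem pathSpan_mul_p (h : IsLeavittFamily G P S T) {C : Set (List E)} {x : B}
    (hx : x ∈ pathSpan R P S C) (A : G.GenVertex) : x * P A ∈ pathSpan R P S C := by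
  refine map_mem_of_mem_pathSpan _ (LinearMap.mulRight R (P A)) (fun α hα A' => ?_) hx
  rw [LinearMap.mulRight_apply, mul_assoc, h.p_mul]
  exact mem_pathSpan hα _

theorem p_mul_pathSpan (h : IsLeavittFamily G P S T) {C : Set (List E)} {x : B}
    (hx : x ∈ pathSpan R P S C) (A : G.GenVertex) : P A * x ∈ pathSpan R P S C := by
  refine map_mem_of_mem_pathSpan _ (LinearMap.mulLeft R (P A)) (fun α hα A' => ?_) hx
  rw [LinearMap.mulLeft_apply]
  cases α with
  | nil =>
    simpa [h.p_mul] using mem_pathSpan (R := R) (P := P) (S := S) hα (A.inter A')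
  | cons e α =>
    rw [← mul_assoc]
    by_cases he : G.source e ∈ A.toSet
    · rw [h.p_mul_path α he]
      exact mem_pathSpan hα _
    · rw [h.p_mul_path_of_notMem α he, zero_mul]
      exact zero_mem _

theorem s_mul_pathSpan {C D : Set (List E)} {x : B}
    (hx : x ∈ pathSpan R P S C) (e : E) (hCD : ∀ α ∈ C, e :: α ∈ D) :
    S e * x ∈ pathSpan R P S D := by
  refine map_mem_of_mem_pathSpan _ (LinearMap.mulLeft R (S e)) (fun α hα A' => ?_) hx
  rw [LinearMap.mulLeft_apply, ← mul_assoc, ← List.prod_cons, ← List.map_cons]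
  exact mem_pathSpan (hCD α hα) _

theorem pathSpan_mul_s (h : IsLeavittFamily G P S T) {C D : Set (List E)} {x : B}
    (hx : x ∈ pathSpan R P S C) (e : E) (hCD : ∀ α ∈ C, α ++ [e] ∈ D) :
    x * S e ∈ pathSpan R P S D := by
  refine map_mem_of_mem_pathSpan _ (LinearMap.mulRight R (S e)) (fun α hα A => ?_) hx
  rw [LinearMap.mulRight_apply, mul_assoc]
  by_cases he : G.source e ∈ A.toSet
  · have := mem_pathSpan (R := R) (P := P) (S := S) (hCD α hα) (.range G e)
    rw [List.map_append, List.prod_append, List.map_singleton, List.prod_singleton, mul_assoc,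
      h.s_range] at this
    rwa [h.p_mul_s he]
  · rw [h.p_mul_s_of_notMem he, mul_zero]
    exact zero_mem _

theorem sStar_mul_pathSpan (h : IsLeavittFamily G P S T) {C D : Set (List E)} {x : B}
    (hx : x ∈ pathSpan R P S C) (e : E) (hC : [] ∉ C) (hCD : ∀ α, e :: α ∈ C → α ∈ D) :
    T e * x ∈ pathSpan R P S D := by
  refine map_mem_of_mem_pathSpan _ (LinearMap.mulLeft R (T e)) (fun α hα A => ?_) hx
  rw [LinearMap.mulLeft_apply]
  cases α with
  | nil => exact absurd hα hC
  | cons f α =>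
    rw [List.map_cons, List.prod_cons, ← mul_assoc, ← mul_assoc]
    by_cases hef : e = f
    · subst hef
      rw [h.sStar_s_self, mul_assoc]
      exact h.p_mul_pathSpan (mem_pathSpan (hCD α hα) A) _
    · rw [h.sStar_s_ne e f hef, zero_mul, zero_mul]
      exact zero_mem _

/-- Conjugating by an edge keeps the length of every path. -/
theorem sStar_mul_pathSpan_mul_s (h : IsLeavittFamily G P S T) {x : B}
    (hx : x ∈ pathSpan R P S {α | α ≠ []}) (e : E) :
    T e * x * S e ∈ pathSpan R P S {α | α ≠ []} :=
  h.pathSpan_mul_s (h.sStar_mul_pathSpan (D := Set.univ) hx e (fun h' => h' rfl)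
    fun _ _ => trivial) e fun α _ => by simp

/-! ### The span of the projections -/

theorem exists_smul_vertex (h : IsLeavittFamily G P S T) {f : B} (hf : f ∈ pathSpan R P S {[]})
    (v : V) : ∃ r : R, f * P (.vertex G v) = r • P (.vertex G v) := by
  induction hf using Submodule.span_induction with
  | mem x hx =>
    obtain ⟨_, rfl, A, rfl⟩ := hx
    rw [List.map_nil, List.prod_nil, one_mul]
    by_cases hv : v ∈ A.toSet
    · exact ⟨1, by rw [h.p_mul_vertex hv, one_smul]⟩
    · exact ⟨0, by rw [h.p_mul_vertex_of_notMem hv, zero_smul]⟩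
  | zero => exact ⟨0, by simp⟩
  | add x y _ _ hx hy =>
    obtain ⟨r, hr⟩ := hx
    obtain ⟨t, ht⟩ := hy
    exact ⟨r + t, by rw [add_mul, hr, ht, add_smul]⟩
  | smul a x _ hx =>
    obtain ⟨r, hr⟩ := hx
    exact ⟨a * r, by rw [smul_mul_assoc, hr, mul_smul]⟩

theorem smul_vertex_eq_zero (hI : VertexIndependent R P S) {v : V} {r : R}
    (hr : r • P (.vertex G v) = 0) : r = 0 :=
  hI v r (hr ▸ zero_mem _)

/-- A combination of projections that vanishes at every vertex of `A \ C` vanishes on `A \ C`: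
split `A \ C` along the sets that occur in the combination, until the combination is constant on
each part. -/
theorem mul_p_mul_one_sub_p_eq_zero (h : IsLeavittFamily G P S T) (hI : VertexIndependent R P S)
    (L : List (R × G.GenVertex)) (a : R) (A C : G.GenVertex)
    (hv : ∀ v ∈ A.toSet, v ∉ C.toSet →
      (algebraMap R B a + (L.map fun q => q.1 • P q.2).sum) * P (.vertex G v) = 0) :
    (algebraMap R B a + (L.map fun q => q.1 • P q.2).sum) * (P A * (1 - P C)) = 0 := by
  induction L generalizing a A C with
  | nil =>
    by_cases hAC : ∃ v ∈ A.toSet, v ∉ C.toSet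
    · obtain ⟨v, hA, hC⟩ := hAC
      have := hv v hA hC
      rw [List.map_nil, List.sum_nil, add_zero, ← Algebra.smul_def] at this
      rw [smul_vertex_eq_zero hI this]
      simp
    · push Not at hAC
      have : P A * P C = P A := by
        rw [h.p_mul]
        exact congrArg P (GenVertex.ext fun v => by simpa using hAC v)
      rw [mul_sub, mul_one, this, sub_self, mul_zero]
  | cons q L ih =>
    obtain ⟨r, D⟩ := q
    simp only [List.map_cons, List.sum_cons] at hv ⊢
    set Y := (L.map fun q => q.1 • P q.2).sum with hY
    have h1 : (algebraMap R B (a + r) + Y) * (P (A.inter D) * (1 - P C)) = 0 := by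
      refine ih (a + r) (A.inter D) C fun v hvA hvC => ?_
      rw [← hv v hvA.1 hvC, map_add, add_mul, add_mul, add_mul, add_mul, smul_mul_assoc,
        h.p_mul_vertex hvA.2, ← Algebra.smul_def r]
      abel
    have h2 : (algebraMap R B a + Y) * (P A * (1 - P (C.union D))) = 0 := by
      refine ih a A (C.union D) fun v hvA hvC => ?_
      rw [GenVertex.mem_union, not_or] at hvC
      rw [← hv v hvA hvC.1, add_mul, add_mul, add_mul, smul_mul_assoc,
        h.p_mul_vertex_of_notMem hvC.2, smul_zero, zero_add]
    have e1 : P D * (P (A.inter D) * (1 - P C)) = P (A.inter D) * (1 - P C) := by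
      rw [← mul_assoc, ← h.p_mul A D, h.p_comm A D, ← mul_assoc, h.p_mul_self]
    have e2 : P D * (P A * (1 - P (C.union D))) = 0 := by
      rw [← mul_assoc, h.p_comm D A, mul_assoc, mul_sub, mul_one, h.p_mul D]
      have : D.inter (C.union D) = D := GenVertex.ext fun v => by
        simp +contextual
      rw [this, sub_self, mul_zero]
    have e3 : P A * (1 - P C) = P (A.inter D) * (1 - P C) + P A * (1 - P (C.union D)) := by
      rw [h.p_union, ← h.p_mul, ← h.p_mul, h.p_comm C D]
      noncomm_ring
    have h1' : (algebraMap R B a + (r • P D + Y)) * (P (A.inter D) * (1 - P C)) = 0 := by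
      rw [← h1, map_add, add_mul, add_mul, add_mul, add_mul, smul_mul_assoc, e1,
        ← Algebra.smul_def r]
      abel
    have h2' : (algebraMap R B a + (r • P D + Y)) * (P A * (1 - P (C.union D))) = 0 := by
      rw [← h2, add_mul, add_mul, add_mul, smul_mul_assoc, e2, smul_zero, zero_add]
    rw [e3, mul_add, h1', h2', add_zero]

/-- A combination of projections is determined by its values at the vertices. -/
theorem eq_zero_of_mul_vertex_of_mem_span_p (h : IsLeavittFamily G P S T)
    (hI : VertexIndependent R P S) {f : B} (hf : f ∈ pathSpan R P S {[]})
    (hv : ∀ v, f * P (.vertex G v) = 0) : f = 0 := by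
  obtain ⟨L, A, hL, hA⟩ : ∃ (L : List (R × G.GenVertex)) (A : G.GenVertex),
      f = (L.map fun q => q.1 • P q.2).sum ∧ f * P A = f := by
    clear hv
    induction hf using Submodule.span_induction with
    | mem x hx =>
      obtain ⟨_, rfl, A, rfl⟩ := hx
      exact ⟨[(1, A)], A, by simp, by simp [h.p_mul_self]⟩
    | zero => exact ⟨[], .empty G, by simp, by simp⟩
    | add x y _ _ hx hy =>
      obtain ⟨L, A, hL, hA⟩ := hx
      obtain ⟨M, C, hM, hC⟩ := hy
      have hA' : x * P (A.union C) = x := by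
        conv_lhs => rw [← hA, mul_assoc, h.p_mul]
        rw [show A.inter (A.union C) = A from GenVertex.ext fun v => by simp +contextual, hA]
      have hC' : y * P (A.union C) = y := by
        conv_lhs => rw [← hC, mul_assoc, h.p_mul]
        rw [show C.inter (A.union C) = C from GenVertex.ext fun v => by simp +contextual, hC]
      exact ⟨L ++ M, A.union C, by rw [List.map_append, List.sum_append, hL, hM],
        by rw [add_mul, hA', hC']⟩
    | smul a x _ hx =>
      obtain ⟨L, A, hL, hA⟩ := hx
      refine ⟨L.map fun q => (a * q.1, q.2), A, ?_, by rw [smul_mul_assoc, hA]⟩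
      rw [hL, List.smul_sum, List.map_map, List.map_map]
      simp [Function.comp_def, mul_smul]
  have := h.mul_p_mul_one_sub_p_eq_zero hI L 0 A (.empty G) fun v _ _ => by
    rw [map_zero, zero_add, ← hL, hv]
  rwa [map_zero, zero_add, ← hL, h.p_empty, sub_zero, mul_one, hA] at this

/-! ### Elements without ghost edges -/

theorem exists_eq_add_sum_s_mul (h : IsLeavittFamily G P S T) {n : ℕ} {x : B}
    (hx : x ∈ pathSpan R P S {α | α.length ≤ n + 1}) :
    ∃ f ∈ pathSpan R P S {[]}, ∃ g : E →₀ B,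
      (∀ e, g e ∈ pathSpan R P S {α | α.length ≤ n} ∧ P (.range G e) * g e = g e) ∧
      x = f + g.sum fun e a => S e * a := by
  classical
  induction hx using Submodule.span_induction with
  | mem x hx =>
    obtain ⟨α, hα, A, rfl⟩ := hx
    cases α with
    | nil => exact ⟨_, mem_pathSpan (Set.mem_singleton []) A, 0, by simp, by simp⟩
    | cons e α =>
      refine ⟨0, zero_mem _, .single e (P (.range G e) * ((α.map S).prod * P A)), fun e' => ?_, ?_⟩
      · rcases eq_or_ne e e' with rfl | hne
        · rw [Finsupp.single_eq_same, ← mul_assoc (P _) (P _), h.p_mul_self]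
          exact ⟨h.p_mul_pathSpan (mem_pathSpan (by simpa using hα) A) _, rfl⟩
        · rw [Finsupp.single_eq_of_ne hne.symm]
          simp
      · rw [Finsupp.sum_single_index (mul_zero _), zero_add, ← mul_assoc, h.s_range,
          List.map_cons, List.prod_cons, mul_assoc]
  | zero => exact ⟨0, zero_mem _, 0, by simp, by simp⟩
  | add x y _ _ hx hy =>
    obtain ⟨f, hf, g, hg, rfl⟩ := hx
    obtain ⟨f', hf', g', hg', rfl⟩ := hy
    refine ⟨f + f', add_mem hf hf', g + g', fun e => ⟨add_mem (hg e).1 (hg' e).1, ?_⟩, ?_⟩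
    · rw [Finsupp.add_apply, mul_add, (hg e).2, (hg' e).2]
    · rw [Finsupp.sum_add_index' (by simp) (by simp [mul_add])]
      abel
  | smul a x _ hx =>
    obtain ⟨f, hf, g, hg, rfl⟩ := hx
    refine ⟨a • f, Submodule.smul_mem _ a hf, a • g,
      fun e => ⟨Submodule.smul_mem _ a (hg e).1, ?_⟩, ?_⟩
    · rw [Finsupp.smul_apply, mul_smul_comm, (hg e).2]
    · rw [Finsupp.sum_smul_index' (by simp), smul_add, Finsupp.smul_sum]
      simp

theorem sStar_mul_sum (h : IsLeavittFamily G P S T) (g : E →₀ B) (e : E)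
    (hg : P (.range G e) * g e = g e) : T e * (g.sum fun e a => S e * a) = g e := by
  classical
  rw [Finsupp.mul_sum, Finsupp.sum, Finset.sum_eq_single e]
  · rw [← mul_assoc, h.sStar_s_self, hg]
  · intro e' _ hne
    rw [← mul_assoc, h.sStar_s_ne e e' hne.symm, zero_mul]
  · intro he
    rw [Finsupp.notMem_support_iff.1 he, mul_zero, mul_zero]

theorem sum_s_mul_mem_pathSpan {C : Set (List E)} (g : E →₀ B)
    (hg : ∀ e, g e ∈ pathSpan R P S C) :
    (g.sum fun e a => S e * a) ∈ pathSpan R P S {α | α ≠ []} :=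
  sum_mem fun e _ => s_mul_pathSpan (hg e) e fun α _ => List.cons_ne_nil e α

theorem eq_zero_of_mul_vertex (h : IsLeavittFamily G P S T) (hI : VertexIndependent R P S) {n : ℕ}
    {x : B} (hx : x ∈ pathSpan R P S {α | α.length ≤ n}) (hv : ∀ v, x * P (.vertex G v) = 0) :
    x = 0 := by
  induction n generalizing x with
  | zero =>
    refine h.eq_zero_of_mul_vertex_of_mem_span_p hI (pathSpan_mono (fun α hα => ?_) hx) hv
    simpa using hα
  | succ n ih =>
    obtain ⟨f, hf, g, hg, rfl⟩ := h.exists_eq_add_sum_s_mul hx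
    have hf0 : f = 0 := by
      refine h.eq_zero_of_mul_vertex_of_mem_span_p hI hf fun v => ?_
      obtain ⟨r, hr⟩ := h.exists_smul_vertex hf v
      have h1 := hv v
      rw [add_mul, hr, add_eq_zero_iff_eq_neg] at h1
      rw [hr, hI v r, zero_smul]
      rw [h1]
      exact neg_mem (h.pathSpan_mul_p (sum_s_mul_mem_pathSpan g fun e => (hg e).1) _)
    have hg0 : g = 0 := by
      ext e
      refine ih (hg e).1 fun v => ?_
      rw [← h.sStar_mul_sum g e (hg e).2, mul_assoc]
      have := hv v
      rw [hf0, zero_add] at this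
      rw [this, mul_zero]
    simp [hf0, hg0]

/-- Removing a shortest path from the left turns an element without ghost edges that ends at `v`
into a nonzero multiple of `p_v` plus terms of positive length. -/
theorem exists_word_mul_eq (h : IsLeavittFamily G P S T) {n : ℕ}
    {x : B} {v : V} (hx : x ∈ pathSpan R P S {α | α.length ≤ n}) (hx0 : x ≠ 0)
    (hv : x * P (.vertex G v) = x) :
    ∃ μ ∈ wordsOf P S T, ∃ r : R, r ≠ 0 ∧ ∃ z ∈ pathSpan R P S {α | α ≠ []},
      μ * x = r • P (.vertex G v) + z := by
  induction n generalizing x with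
  | zero =>
    obtain ⟨r, hr⟩ := h.exists_smul_vertex
      (pathSpan_mono (D := {[]}) (fun α hα => by simpa using hα) hx) v
    rw [hv] at hr
    refine ⟨_, vertex_mem_wordsOf v, r, ?_, 0, zero_mem _, ?_⟩
    · rintro rfl
      exact hx0 (by rw [hr, zero_smul])
    · rw [hr, mul_smul_comm, h.p_mul_self, add_zero]
  | succ n ih =>
    obtain ⟨f, hf, g, hg, rfl⟩ := h.exists_eq_add_sum_s_mul hx
    obtain ⟨r, hr⟩ := h.exists_smul_vertex hf v
    have hs := sum_s_mul_mem_pathSpan g fun e => (hg e).1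
    set y := g.sum fun e a => S e * a with hy
    rw [add_mul, hr] at hv
    by_cases hr0 : r = 0
    · rw [hr0, zero_smul, zero_add] at hv
      obtain ⟨e, he⟩ : ∃ e, g e * P (.vertex G v) ≠ 0 := by
        by_contra! hcon
        refine hx0 ?_
        rw [← hv, hy, Finsupp.sum_mul, Finsupp.sum]
        exact Finset.sum_eq_zero fun e _ => by rw [mul_assoc, hcon, mul_zero]
      obtain ⟨μ, hμ, t, ht, z, hz, hμz⟩ := ih (h.pathSpan_mul_p (hg e).1 _) he
        (by rw [mul_assoc, h.p_mul_self])
      refine ⟨μ * T e, mul_mem hμ (ghost_mem_wordsOf e), t, ht, z, hz, ?_⟩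
      rw [← hv, mul_assoc, ← mul_assoc (T e), h.sStar_mul_sum g e (hg e).2, hμz]
    · refine ⟨_, vertex_mem_wordsOf v, r, hr0, _,
        h.p_mul_pathSpan (h.pathSpan_mul_p hs (.vertex G v)) (.vertex G v), ?_⟩
      rw [← hv, mul_add, mul_smul_comm, h.p_mul_self]

theorem mul_s_ne_zero (h : IsLeavittFamily G P S T) (hI : VertexIndependent R P S) {C : Set (List E)}
    {x : B} {e : E} (hx : x ∈ pathSpan R P S C)
    (hx0 : x * P (.vertex G (G.source e)) ≠ 0) : x * S e ≠ 0 := by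
  intro h0
  obtain ⟨n, hn⟩ := exists_mem_pathSpan_length_le hx
  obtain ⟨μ, -, r, hr, z, hz, hμ⟩ := h.exists_word_mul_eq
    (h.pathSpan_mul_p hn (.vertex G (G.source e))) hx0 (by rw [mul_assoc, h.p_mul_self])
  obtain ⟨w, hw⟩ := G.range_nonempty e
  refine hr (hI w r ?_)
  have h1 : T e * (μ * (x * P (.vertex G (G.source e)))) * S e * P (.vertex G w) = 0 := by
    rw [mul_assoc (T e), mul_assoc μ, mul_assoc x, h.source_s, h0]
    simp
  rw [hμ, mul_add, add_mul, add_mul, mul_smul_comm, h.sStar_source, smul_mul_assoc,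
    h.sStar_s_self, smul_mul_assoc, h.p_mul_vertex hw, add_eq_zero_iff_eq_neg] at h1
  rw [h1]
  exact neg_mem (h.pathSpan_mul_p (h.sStar_mul_pathSpan_mul_s hz e) _)

/-! ### Removing ghost edges -/

theorem monomialSpan_mul_p (h : IsLeavittFamily G P S T) {C : Set (List E)} {x : B}
    (hx : x ∈ monomialSpan R P S T C) (A : G.GenVertex) : x * P A ∈ monomialSpan R P S T C := by
  refine map_mem_of_mem_monomialSpan _ (LinearMap.mulRight R (P A)) (fun α A' β hβ => ?_) hx
  rw [LinearMap.mulRight_apply]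
  cases β with
  | nil => simpa [h.p_mul, mul_assoc] using
      mem_monomialSpan (R := R) (P := P) (S := S) (T := T) α (A'.inter A) hβ
  | cons e β =>
    have hm := mem_monomialSpan (R := R) (P := P) (S := S) (T := T) α A' hβ
    simp only [List.map_cons, List.reverse_cons, List.prod_append, List.prod_singleton] at hm ⊢
    by_cases he : G.source e ∈ A.toSet
    · rwa [mul_assoc, mul_assoc _ (T e), h.sStar_mul_p he]
    · rw [mul_assoc, mul_assoc _ (T e), h.sStar_mul_p_of_notMem he, mul_zero, mul_zero]
      exact zero_mem _

theorem monomialSpan_mul_sStar {C D : Set (List E)} {x : B}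
    (hx : x ∈ monomialSpan R P S T C) (e : E) (hCD : ∀ β ∈ C, e :: β ∈ D) :
    x * T e ∈ monomialSpan R P S T D := by
  refine map_mem_of_mem_monomialSpan _ (LinearMap.mulRight R (T e)) (fun α A β hβ => ?_) hx
  rw [LinearMap.mulRight_apply, mul_assoc]
  have := mem_monomialSpan (R := R) (P := P) (S := S) (T := T) α A (hCD β hβ)
  rwa [List.map_cons, List.reverse_cons, List.prod_append, List.prod_singleton] at this

theorem monomialSpan_mul_s (h : IsLeavittFamily G P S T) {x : B}
    (hx : x ∈ monomialSpan R P S T Set.univ) (e : E) :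
    x * S e ∈ monomialSpan R P S T Set.univ := by
  refine map_mem_of_mem_monomialSpan _ (LinearMap.mulRight R (S e)) (fun α A β hβ => ?_) hx
  rw [LinearMap.mulRight_apply]
  cases β with
  | nil =>
    by_cases he : G.source e ∈ A.toSet
    · have := mem_monomialSpan (R := R) (P := P) (S := S) (T := T) (α ++ [e]) (.range G e) hβ
      rw [List.map_append, List.prod_append, List.map_singleton, List.prod_singleton,
        mul_assoc (α.map S).prod, h.s_range] at this
      simpa [mul_assoc, h.p_mul_s he] using this
    · simp [mul_assoc, h.p_mul_s_of_notMem he]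
  | cons f β =>
    simp only [List.map_cons, List.reverse_cons, List.prod_append, List.prod_singleton]
    rw [mul_assoc, mul_assoc _ (T f)]
    by_cases hfe : f = e
    · rw [hfe, h.sStar_s_self, ← mul_assoc]
      exact h.monomialSpan_mul_p (mem_monomialSpan α A (Set.mem_univ β)) _
    · rw [h.sStar_s_ne f e hfe, mul_zero, mul_zero]
      exact zero_mem _

theorem adjoin_le_monomialSpan (h : IsLeavittFamily G P S T) {x : B}
    (hx : x ∈ NonUnitalAlgebra.adjoin R (Set.range P ∪ Set.range S ∪ Set.range T)) :
    x ∈ monomialSpan R P S T Set.univ := by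
  suffices x ∈ monomialSpan R P S T Set.univ ∧
      ∀ y ∈ monomialSpan R P S T Set.univ, y * x ∈ monomialSpan R P S T Set.univ from this.1
  have hp (A : G.GenVertex) : P A ∈ monomialSpan R P S T Set.univ := by
    simpa using mem_monomialSpan (R := R) (P := P) (S := S) (T := T) [] A (Set.mem_univ [])
  induction hx using NonUnitalAlgebra.adjoin_induction with
  | mem x hx =>
    rcases hx with (⟨A, rfl⟩ | ⟨e, rfl⟩) | ⟨e, rfl⟩
    · exact ⟨hp A, fun y hy => h.monomialSpan_mul_p hy A⟩
    · refine ⟨?_, fun y hy => h.monomialSpan_mul_s hy e⟩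
      rw [← h.source_s]
      exact h.monomialSpan_mul_s (hp _) e
    · refine ⟨?_, fun y hy => monomialSpan_mul_sStar hy e fun _ _ => trivial⟩
      rw [← h.range_sStar]
      exact monomialSpan_mul_sStar (hp _) e fun _ _ => trivial
  | add x y _ _ hx hy =>
    exact ⟨add_mem hx.1 hy.1, fun z hz => by rw [mul_add]; exact add_mem (hx.2 z hz) (hy.2 z hz)⟩
  | zero => exact ⟨zero_mem _, fun z _ => by rw [mul_zero]; exact zero_mem _⟩
  | mul x y _ _ hx hy =>
    exact ⟨hy.2 x hx.1, fun z hz => by rw [← mul_assoc]; exact hy.2 _ (hx.2 z hz)⟩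
  | smul r x _ hx =>
    exact ⟨Submodule.smul_mem _ r hx.1,
      fun z hz => by rw [mul_smul_comm]; exact Submodule.smul_mem _ r (hx.2 z hz)⟩

theorem exists_eq_add_sum_mul_sStar {n : ℕ} {x : B}
    (hx : x ∈ monomialSpan R P S T {β | β.length ≤ n + 1}) :
    ∃ f ∈ pathSpan R P S Set.univ, ∃ g : E →₀ B,
      (∀ e, g e ∈ monomialSpan R P S T {β | β.length ≤ n}) ∧
      x = f + g.sum fun e a => a * T e := by
  classical
  induction hx using Submodule.span_induction with
  | mem x hx =>
    obtain ⟨α, A, β, hβ, rfl⟩ := hx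
    cases β with
    | nil => exact ⟨_, mem_pathSpan (Set.mem_univ α) A, 0, by simp, by simp⟩
    | cons e β =>
      refine ⟨0, zero_mem _, .single e ((α.map S).prod * P A * ((β.map T).reverse).prod),
        fun e' => ?_, ?_⟩
      · rcases eq_or_ne e e' with rfl | hne
        · rw [Finsupp.single_eq_same]
          exact mem_monomialSpan α A (by simpa using hβ)
        · rw [Finsupp.single_eq_of_ne hne.symm]
          exact zero_mem _
      · rw [Finsupp.sum_single_index (zero_mul _), zero_add, List.map_cons, List.reverse_cons,
          List.prod_append, List.prod_singleton, mul_assoc _ _ (T e)]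
  | zero => exact ⟨0, zero_mem _, 0, by simp, by simp⟩
  | add x y _ _ hx hy =>
    obtain ⟨f, hf, g, hg, rfl⟩ := hx
    obtain ⟨f', hf', g', hg', rfl⟩ := hy
    refine ⟨f + f', add_mem hf hf', g + g', fun e => add_mem (hg e) (hg' e), ?_⟩
    rw [Finsupp.sum_add_index' (by simp) (by simp [add_mul])]
    abel
  | smul a x _ hx =>
    obtain ⟨f, hf, g, hg, rfl⟩ := hx
    refine ⟨a • f, Submodule.smul_mem _ a hf, a • g, fun e => Submodule.smul_mem _ a (hg e), ?_⟩
    rw [Finsupp.sum_smul_index' (by simp), smul_add, Finsupp.smul_sum]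
    simp

theorem sum_mul_sStar_mul_s (h : IsLeavittFamily G P S T) (g : E →₀ B) (e : E) :
    (g.sum fun e a => a * T e) * S e = g e * P (.range G e) := by
  classical
  rw [Finsupp.sum_mul, Finsupp.sum, Finset.sum_eq_single e]
  · rw [mul_assoc, h.sStar_s_self]
  · intro e' _ hne
    rw [mul_assoc, h.sStar_s_ne e' e hne, mul_zero]
  · intro he
    rw [Finsupp.notMem_support_iff.1 he, zero_mul, zero_mul]

/-- If an element dies on right multiplication by every edge, then it has no ghost edges: writing
it as `x₀ + ∑ g_e s_e^*` with `x₀` without ghost edges, it equals `x₀ (1 - ∑ s_e s_e^*)`, and it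
vanishes at the sources of the finitely many edges of the sum. -/
theorem mem_pathSpan_of_mul_s_eq_zero (h : IsLeavittFamily G P S T) (hI : VertexIndependent R P S)
    {f : B} (hf : f ∈ pathSpan R P S Set.univ) (g : E →₀ B)
    (h0 : ∀ e, (f + g.sum fun e a => a * T e) * S e = 0) :
    (f + g.sum fun e a => a * T e) ∈ pathSpan R P S Set.univ := by
  classical
  set x := f + g.sum fun e a => a * T e with hx
  have hsum (A : G.GenVertex) (hA : ∀ e ∈ g.support, G.source e ∈ A.toSet) :
      (g.sum fun e a => a * T e) * P A = g.sum fun e a => a * T e := by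
    rw [Finsupp.sum_mul]
    exact Finset.sum_congr rfl fun e he => by
      beta_reduce; rw [mul_assoc, h.sStar_mul_p (hA e he)]
  have hvert : ∀ e, x * P (.vertex G (G.source e)) = 0 := by
    intro e
    set v := G.source e with hv
    by_cases hfin : {e | G.source e = v}.Finite
    · rw [h.sum_source v hfin ⟨e, rfl⟩, Finset.mul_sum]
      exact Finset.sum_eq_zero fun e' _ => by rw [← mul_assoc, h0, zero_mul]
    · -- At an infinite emitter some edge does not occur in the sum, so it already kills `f`.
      obtain ⟨e', he', hg⟩ := Set.Infinite.exists_notMem_finset hfin g.support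
      have hfv : f * P (.vertex G v) = 0 := by
        by_contra hcon
        rw [← show G.source e' = v from he'] at hcon
        refine h.mul_s_ne_zero hI hf hcon ?_
        have := h0 e'
        rwa [hx, add_mul, h.sum_mul_sStar_mul_s, Finsupp.notMem_support_iff.1 hg, zero_mul,
          add_zero] at this
      have hg' : (g.sum fun e a => a * T e) * P (.vertex G v) = 0 := by
        rw [Finsupp.sum_mul]
        refine Finset.sum_eq_zero fun e _ => ?_
        beta_reduce
        by_cases hev : G.source e = v
        · have h1 := h0 e
          rw [hx, add_mul, h.sum_mul_sStar_mul_s, ← h.source_s e, hev, ← mul_assoc, hfv, zero_mul,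
            zero_add] at h1
          rw [← h.range_sStar e, ← mul_assoc (g e), h1, zero_mul, zero_mul]
        · rw [mul_assoc, h.sStar_mul_p_of_notMem (by simpa using hev), mul_zero]
      rw [hx, add_mul, hfv, hg', add_zero]
  obtain ⟨A, hA, hxA⟩ : ∃ A : G.GenVertex, (∀ e ∈ g.support, G.source e ∈ A.toSet) ∧
      x * P A = 0 := by
    induction g.support using Finset.induction_on with
    | empty => exact ⟨.empty G, by simp, by rw [h.p_empty, mul_zero]⟩
    | insert e s _ ih =>
      obtain ⟨A, hA, hxA⟩ := ih
      refine ⟨A.union (.vertex G (G.source e)), fun e' he' => ?_, ?_⟩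
      · rcases Finset.mem_insert.1 he' with rfl | he'
        · exact Or.inr rfl
        · exact Or.inl (hA e' he')
      · rw [h.p_union, ← h.p_mul, mul_sub, mul_add, ← mul_assoc, hxA, hvert]
        simp
  have hxf : x = f - f * P A := by
    have h1 := hxA
    rw [hx, add_mul, hsum A hA] at h1
    rw [hx, eq_neg_of_add_eq_zero_right h1, sub_eq_add_neg]
  rw [hxf]
  exact sub_mem hf (h.pathSpan_mul_p hf A)

theorem exists_mul_word_mem_pathSpan (h : IsLeavittFamily G P S T) (hI : VertexIndependent R P S)
    {n : ℕ} {x : B} (hx : x ∈ monomialSpan R P S T {β | β.length ≤ n}) (hx0 : x ≠ 0) :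
    ∃ ν ∈ wordsOf P S T, ∃ v, x * ν ∈ pathSpan R P S Set.univ ∧ x * ν ≠ 0 ∧
      x * ν * P (.vertex G v) = x * ν := by
  have key {y : B} (hy : y ∈ pathSpan R P S Set.univ) (hy0 : y ≠ 0) :
      ∃ ν ∈ wordsOf P S T, ∃ v, y * ν ∈ pathSpan R P S Set.univ ∧ y * ν ≠ 0 ∧
        y * ν * P (.vertex G v) = y * ν := by
    obtain ⟨m, hm⟩ := exists_mem_pathSpan_length_le hy
    obtain ⟨v, hv⟩ : ∃ v, y * P (.vertex G v) ≠ 0 := by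
      by_contra! hcon
      exact hy0 (h.eq_zero_of_mul_vertex hI hm hcon)
    exact ⟨_, vertex_mem_wordsOf v, v, h.pathSpan_mul_p hy _, hv,
      by rw [mul_assoc, h.p_mul_self]⟩
  induction n generalizing x with
  | zero =>
    refine key ?_ hx0
    refine map_mem_of_mem_monomialSpan (pathSpan R P S Set.univ) LinearMap.id
      (fun α A β hβ => ?_) hx
    obtain rfl : β = [] := by simpa using hβ
    simpa using mem_pathSpan (R := R) (P := P) (S := S) (Set.mem_univ α) A
  | succ n ih =>
    obtain ⟨f, hf, g, hg, rfl⟩ := exists_eq_add_sum_mul_sStar hx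
    by_cases h0 : ∀ e, (f + g.sum fun e a => a * T e) * S e = 0
    · exact key (h.mem_pathSpan_of_mul_s_eq_zero hI hf g h0) hx0
    · push Not at h0
      obtain ⟨e, he⟩ := h0
      obtain ⟨ν, hν, v, h1, h2, h3⟩ := ih (x := (f + g.sum fun e a => a * T e) * S e) (by
        rw [add_mul, h.sum_mul_sStar_mul_s]
        refine add_mem ?_ (h.monomialSpan_mul_p (hg e) _)
        have hfe := h.pathSpan_mul_s (D := Set.univ) hf e fun _ _ => trivial
        refine map_mem_of_mem_pathSpan _ LinearMap.id (fun α _ A => ?_) hfe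
        simpa using mem_monomialSpan (R := R) (P := P) (S := S) (T := T)
          (C := {β | β.length ≤ n}) α A (β := []) (by simp)) he
      refine ⟨S e * ν, mul_mem (edge_mem_wordsOf e) hν, v, ?_⟩
      rw [← mul_assoc]
      exact ⟨h1, h2, h3⟩

end LPA.IsLeavittFamily
/-! ### Deterministic sets of vertices -/

/-- Every vertex `v` of `D` emits exactly one edge `ε v`, and the range of `ε v` is the single
vertex `σ v`, again in `D`. -/
structure IsDeterministic (G : Ultragraph V E) (D : Set V) (ε : V → E) (σ : V → V) : Prop where
  source_eq : ∀ v ∈ D, G.source (ε v) = v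
  eq_of_source_eq : ∀ v ∈ D, ∀ e, G.source e = v → e = ε v
  range_eq : ∀ v ∈ D, G.range (ε v) = {σ v}
  map_mem : ∀ v ∈ D, σ v ∈ D

/-- The first `m` edges of the trajectory of `v` when every vertex `u` is left along `ε u`
to `σ u`. -/
def orbitPath (ε : V → E) (σ : V → V) (m : ℕ) (v : V) : List E :=
  (List.range m).map fun i => ε (σ^[i] v)

section OrbitPath

variable (ε : V → E) (σ : V → V)

theorem orbitPath_zero (v : V) : orbitPath ε σ 0 v = [] := rfl

theorem orbitPath_succ (m : ℕ) (v : V) :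
    orbitPath ε σ (m + 1) v = ε v :: orbitPath ε σ m (σ v) := by
  simp [orbitPath, List.range_succ_eq_map]

theorem orbitPath_add (m n : ℕ) (v : V) :
    orbitPath ε σ (m + n) v = orbitPath ε σ m v ++ orbitPath ε σ n (σ^[m] v) := by
  induction m generalizing v with
  | zero => simp [orbitPath_zero]
  | succ m ih =>
    rw [Nat.succ_add, orbitPath_succ, orbitPath_succ, ih, List.cons_append,
      Function.iterate_succ_apply]

end OrbitPath

namespace IsDeterministic

variable {G : Ultragraph V E} {D : Set V} {ε : V → E} {σ : V → V}

theorem iterate_mem (hD : IsDeterministic G D ε σ) {v : V} (hv : v ∈ D) (m : ℕ) :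
    σ^[m] v ∈ D := by
  induction m generalizing v with
  | zero => exact hv
  | succ m ih => exact ih (hD.map_mem v hv)

theorem mem_range_iff (hD : IsDeterministic G D ε σ) {v : V} (hv : v ∈ D) (i : ℕ) (w : V) :
    w ∈ G.range (ε (σ^[i] v)) ↔ w = σ^[i + 1] v := by
  rw [hD.range_eq _ (hD.iterate_mem hv i), Function.iterate_succ_apply', Set.mem_singleton_iff]

theorem isCycle_orbitPath (hD : IsDeterministic G D ε σ) {v : V} (hv : v ∈ D)
    (hper : 0 < Function.minimalPeriod σ v) :
    G.IsCycle (orbitPath ε σ (Function.minimalPeriod σ v) v) := by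
  set n := Function.minimalPeriod σ v with hn
  have hsrc (i : ℕ) : G.source (ε (σ^[i] v)) = σ^[i] v := hD.source_eq _ (hD.iterate_mem hv i)
  have hne : orbitPath ε σ n v ≠ [] := by simp [orbitPath, hper.ne']
  refine ⟨⟨⟨hne, ?_⟩, hne, ?_⟩, ?_⟩
  · rw [List.isChain_iff_getElem]
    intro i hi
    simp only [orbitPath, List.getElem_map, List.getElem_range]
    rw [hD.mem_range_iff hv, hsrc]
  · rw [List.head_eq_getElem, List.getLast_eq_getElem]
    simp only [orbitPath, List.getElem_map, List.getElem_range, List.length_map,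
      List.length_range]
    rw [hD.mem_range_iff hv, hsrc, Nat.sub_add_cancel hper, hn, Function.iterate_minimalPeriod]
    rfl
  · rw [orbitPath, List.map_map]
    refine List.Nodup.map_on (fun i hi j hj hij => ?_) List.nodup_range
    simp only [Function.comp_apply, hsrc] at hij
    exact Function.iterate_injOn_Iio_minimalPeriod (List.mem_range.1 hi) (List.mem_range.1 hj) hij

theorem not_hasExit_orbitPath (hD : IsDeterministic G D ε σ) {v : V} (hv : v ∈ D) :
    ¬ G.HasExit (orbitPath ε σ (Function.minimalPeriod σ v) v) := by
  rintro (⟨i, hi, e, he, hne⟩ | ⟨w, hw, f, hf, hwf⟩)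
  · simp only [orbitPath, List.getElem_map, List.getElem_range, List.length_map,
      List.length_range, Function.iterate_mod_minimalPeriod_eq] at he hne
    exact hne (hD.eq_of_source_eq _ (hD.iterate_mem hv _) e ((hD.mem_range_iff hv i _).1 he))
  · obtain ⟨i, -, rfl⟩ := List.mem_map.1 hf
    rw [hD.mem_range_iff hv] at hwf
    subst hwf
    exact hw _ (hD.source_eq _ (hD.iterate_mem hv _))

section LeavittFamily

open LPA

variable {B : Type z} [Ring B] {P : G.GenVertex → B} {S T : E → B}

theorem s_mul_vertex (hD : IsDeterministic G D ε σ) (h : IsLeavittFamily G P S T) {v : V}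
    (hv : v ∈ D) : S (ε v) * P (.vertex G (σ v)) = S (ε v) := by
  rw [show GenVertex.vertex G (σ v) = GenVertex.range G (ε v) from
    Subtype.ext (hD.range_eq v hv).symm, h.s_range]

theorem sStar_mul_s (hD : IsDeterministic G D ε σ) (h : IsLeavittFamily G P S T) {v : V}
    (hv : v ∈ D) : T (ε v) * S (ε v) = P (.vertex G (σ v)) := by
  rw [show GenVertex.vertex G (σ v) = GenVertex.range G (ε v) from
    Subtype.ext (hD.range_eq v hv).symm, h.sStar_s_self]

theorem vertex_mul_s (hD : IsDeterministic G D ε σ) (h : IsLeavittFamily G P S T) {v : V}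
    (hv : v ∈ D) : P (.vertex G v) * S (ε v) = S (ε v) :=
  h.p_mul_s (hD.source_eq v hv)

theorem vertex_mul_orbitPath (hD : IsDeterministic G D ε σ) (h : IsLeavittFamily G P S T) {v : V}
    (hv : v ∈ D) (m : ℕ) :
    P (.vertex G v) * ((orbitPath ε σ m v).map S).prod =
      ((orbitPath ε σ m v).map S).prod * P (.vertex G (σ^[m] v)) := by
  induction m generalizing v with
  | zero => simp [orbitPath_zero]
  | succ m ih =>
    rw [orbitPath_succ, List.map_cons, List.prod_cons, ← mul_assoc, hD.vertex_mul_s h hv,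
      Function.iterate_succ_apply, mul_assoc, ← ih (hD.map_mem v hv), ← mul_assoc,
      hD.s_mul_vertex h hv]

theorem eq_zero_of_orbitPath_mul (hD : IsDeterministic G D ε σ) (h : IsLeavittFamily G P S T)
    {v : V} (hv : v ∈ D) (m : ℕ) {y : B} (hy : P (.vertex G (σ^[m] v)) * y = y)
    (h0 : ((orbitPath ε σ m v).map S).prod * y = 0) : y = 0 := by
  induction m generalizing v with
  | zero => simpa [orbitPath_zero] using h0
  | succ m ih =>
    refine ih (hD.map_mem v hv) hy ?_
    have h1 := congrArg (T (ε v) * ·) h0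
    simp only [orbitPath_succ, List.map_cons, List.prod_cons, mul_zero] at h1
    rw [mul_assoc, ← mul_assoc (T (ε v)), hD.sStar_mul_s h hv, ← mul_assoc,
      hD.vertex_mul_orbitPath h (hD.map_mem v hv), mul_assoc] at h1
    rwa [← hy]

/-- The only paths that leave a vertex of a deterministic set are those of its trajectory. -/
theorem eq_orbitPath (hD : IsDeterministic G D ε σ) (h : IsLeavittFamily G P S T)
    {v w : V} (hv : v ∈ D) (β : List E)
    (hβ : P (.vertex G v) * ((β.map S).prod * P (.vertex G w)) ≠ 0) :
    β = orbitPath ε σ β.length v ∧ σ^[β.length] v = w := by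
  induction β generalizing v with
  | nil =>
    refine ⟨rfl, ?_⟩
    by_contra hne
    refine hβ ?_
    rw [List.map_nil, List.prod_nil, one_mul, h.p_mul_vertex_of_notMem]
    simpa using fun h' : w = v => hne h'.symm
  | cons e β ih =>
    rw [← mul_assoc] at hβ
    have he : G.source e = v := by
      by_contra hne
      exact hβ (by rw [h.p_mul_path_of_notMem β (by simpa using hne), zero_mul])
    obtain rfl := hD.eq_of_source_eq v hv e he
    rw [h.p_mul_path β (by simpa using he), List.map_cons, List.prod_cons, ← hD.s_mul_vertex h hv, mul_assoc,
      mul_assoc] at hβ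
    obtain ⟨h1, h2⟩ := ih (hD.map_mem v hv) (right_ne_zero_of_mul hβ)
    rw [List.length_cons, orbitPath_succ, Function.iterate_succ_apply, ← h1]
    exact ⟨rfl, h2⟩

end LeavittFamily

end IsDeterministic

/-! ### Minimal reductions -/

namespace LPA.IsLeavittFamily

variable {G : Ultragraph V E} {R : Type w} [CommRing R] {B : Type z} [Ring B] [Algebra R B]
  {P : G.GenVertex → B} {S T : E → B}

/-- The element `r p_v + ∑ t_i s_{β_i} p_v`, where `L` lists the pairs `(t_i, β_i)`. -/
def vertexSum (P : G.GenVertex → B) (S : E → B) (v : V) (r : R) (L : List (R × List E)) : B :=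
  r • P (.vertex G v) + (L.map fun q => q.1 • ((q.2.map S).prod * P (.vertex G v))).sum

variable (P S T) in
/-- Some two-sided multiple of `x` by words is the element `r p_v + ∑ t_i s_{β_i} p_v`, with
`r ≠ 0` and all `β_i` of positive length. -/
def ReducesTo (x : B) (v : V) (r : R) (L : List (R × List E)) : Prop :=
  r ≠ 0 ∧ (∀ q ∈ L, q.2 ≠ []) ∧
    ∃ μ ∈ wordsOf P S T, ∃ ν ∈ wordsOf P S T, μ * x * ν = vertexSum P S v r L

theorem vertexSum_ne_zero (hI : VertexIndependent R P S) {v : V} {r : R} {L : List (R × List E)}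
    (hr : r ≠ 0) (hL : ∀ q ∈ L, q.2 ≠ []) : vertexSum P S v r L ≠ 0 := by
  intro h0
  refine hr (hI v r ?_)
  rw [vertexSum, add_eq_zero_iff_eq_neg] at h0
  rw [h0]
  refine neg_mem (list_sum_mem fun y hy => ?_)
  obtain ⟨q, hq, rfl⟩ := List.mem_map.1 hy
  exact Submodule.smul_mem _ _ (mem_pathSpan (hL q hq) _)

theorem exists_list_mul_vertex (h : IsLeavittFamily G P S T) {z : B} (v : V)
    (hz : z ∈ pathSpan R P S {α | α ≠ []}) : ∃ L : List (R × List E), (∀ q ∈ L, q.2 ≠ []) ∧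
      z * P (.vertex G v) =
        (L.map fun q => q.1 • ((q.2.map S).prod * P (.vertex G v))).sum := by
  induction hz using Submodule.span_induction with
  | mem x hx =>
    obtain ⟨α, hα, A, rfl⟩ := hx
    by_cases hv : v ∈ A.toSet
    · exact ⟨[(1, α)], by simpa using hα, by simp [mul_assoc, h.p_mul_vertex hv]⟩
    · exact ⟨[], by simp, by simp [mul_assoc, h.p_mul_vertex_of_notMem hv]⟩
  | zero => exact ⟨[], by simp, by simp⟩
  | add x y _ _ hx hy =>
    obtain ⟨L, hL, hx⟩ := hx
    obtain ⟨M, hM, hy⟩ := hy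
    refine ⟨L ++ M, fun q hq => ?_, by rw [add_mul, hx, hy, List.map_append, List.sum_append]⟩
    exact (List.mem_append.1 hq).elim (hL q) (hM q)
  | smul a x _ hx =>
    obtain ⟨L, hL, hx⟩ := hx
    refine ⟨L.map fun q => (a * q.1, q.2), fun q hq => ?_, ?_⟩
    · obtain ⟨q', hq', rfl⟩ := List.mem_map.1 hq
      exact hL q' hq'
    rw [smul_mul_assoc, hx, List.smul_sum, List.map_map, List.map_map]
    simp [Function.comp_def, mul_smul]

theorem exists_list_sum_eq (w : V) (t : R × List E → B) (L : List (R × List E))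
    (ht : ∀ q ∈ L, t q = 0 ∨
      ∃ β : List E, β ≠ [] ∧ t q = q.1 • ((β.map S).prod * P (.vertex G w))) :
    ∃ L' : List (R × List E), (∀ q ∈ L', q.2 ≠ []) ∧
      (L.map t).sum = (L'.map fun q => q.1 • ((q.2.map S).prod * P (.vertex G w))).sum ∧
      L'.length ≤ L.length ∧ ((∃ q ∈ L, t q = 0) → L'.length < L.length) := by
  induction L with
  | nil => exact ⟨[], by simp⟩
  | cons q L ih =>
    obtain ⟨L', h1, h2, h3, h4⟩ := ih fun q hq => ht q (List.mem_cons_of_mem _ hq)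
    by_cases hq : t q = 0
    · refine ⟨L', h1, by rw [List.map_cons, List.sum_cons, hq, zero_add, h2], ?_, fun _ => ?_⟩ <;>
      · rw [List.length_cons]
        omega
    · obtain ⟨β, hβ, hβq⟩ := (ht q List.mem_cons_self).resolve_left hq
      refine ⟨(q.1, β) :: L', ?_, ?_, ?_, ?_⟩
      · rintro q' hq'
        rcases List.mem_cons.1 hq' with rfl | hq'
        · exact hβ
        · exact h1 q' hq'
      · rw [List.map_cons, List.sum_cons, List.map_cons, List.sum_cons, h2, hβq]
      · simpa using h3
      · rintro ⟨q', hq', h0⟩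
        rcases List.mem_cons.1 hq' with rfl | hq'
        · exact absurd h0 hq
        · simpa using h4 ⟨q', hq', h0⟩

theorem ReducesTo.mul_mul {x : B} {v w : V} {r : R} {L : List (R × List E)} {a b : B}
    (hx : ReducesTo P S T x v r L) (ha : a ∈ wordsOf P S T) (hb : b ∈ wordsOf P S T)
    (hab : a * P (.vertex G v) * b = P (.vertex G w))
    (hL : ∀ q ∈ L, a * ((q.2.map S).prod * P (.vertex G v)) * b = 0 ∨
      ∃ β : List E, β ≠ [] ∧
        a * ((q.2.map S).prod * P (.vertex G v)) * b = (β.map S).prod * P (.vertex G w)) :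
    ∃ L', ReducesTo P S T x w r L' ∧ L'.length ≤ L.length ∧
      ((∃ q ∈ L, a * ((q.2.map S).prod * P (.vertex G v)) * b = 0) → L'.length < L.length) := by
  obtain ⟨hr, -, μ, hμ, ν, hν, heq⟩ := hx
  obtain ⟨L', h1, h2, h3, h4⟩ := exists_list_sum_eq (P := P) (S := S) w
    (fun q => q.1 • (a * ((q.2.map S).prod * P (.vertex G v)) * b)) L fun q hq => by
      rcases hL q hq with h0 | ⟨β, hβ, h0⟩
      · exact Or.inl (by rw [h0, smul_zero])
      · exact Or.inr ⟨β, hβ, by rw [h0]⟩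
  refine ⟨L', ⟨hr, h1, a * μ, mul_mem ha hμ, ν * b, mul_mem hν hb, ?_⟩, h3, ?_⟩
  · rw [show a * μ * x * (ν * b) = a * (μ * x * ν) * b by simp only [mul_assoc], heq, vertexSum,
      vertexSum, ← h2, mul_add, add_mul, mul_smul_comm, smul_mul_assoc, hab,
      ← List.sum_map_mul_left, ← List.sum_map_mul_right]
    simp only [mul_smul_comm, smul_mul_assoc]
  · rintro ⟨q, hq, h0⟩
    exact h4 ⟨q, hq, by rw [h0, smul_zero]⟩

theorem exists_reducesTo (h : IsLeavittFamily G P S T) (hI : VertexIndependent R P S) {x : B}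
    (hx : x ∈ monomialSpan R P S T Set.univ) (hx0 : x ≠ 0) :
    ∃ (v : V) (r : R) (L : List (R × List E)), ReducesTo P S T x v r L := by
  obtain ⟨n, hn⟩ := exists_mem_monomialSpan_length_le hx
  obtain ⟨ν, hν, v, h1, h2, h3⟩ := h.exists_mul_word_mem_pathSpan hI hn hx0
  obtain ⟨m, hm⟩ := exists_mem_pathSpan_length_le h1
  obtain ⟨μ, hμ, r, hr, z, hz, heq⟩ := h.exists_word_mul_eq hm h2 h3
  obtain ⟨L, hL, hzL⟩ := h.exists_list_mul_vertex v hz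
  refine ⟨v, r, L, hr, hL, μ, hμ, ν, hν, ?_⟩
  rw [mul_assoc, ← h3, ← mul_assoc, heq, add_mul, smul_mul_assoc, h.p_mul_self, hzL, vertexSum]

/-- Conjugation by an edge `e` that starts at `v`, cut down to a vertex `w` of the range of `e`,
kills `s_β p_v` unless `β` begins with `e` and continues at `w`; otherwise it rotates `β`. -/
theorem conj_path (h : IsLeavittFamily G P S T) (e : E) {w : V} (hw : w ∈ G.range e)
    {β : List E} (hβ : β ≠ []) :
    P (.vertex G w) * T e * ((β.map S).prod * P (.vertex G (G.source e))) *
        (S e * P (.vertex G w)) = 0 ∨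
      ∃ β' f γ, β = e :: β' ∧ β' ++ [e] = f :: γ ∧ G.source f = w ∧
        P (.vertex G w) * T e * ((β.map S).prod * P (.vertex G (G.source e))) *
          (S e * P (.vertex G w)) = ((β' ++ [e]).map S).prod * P (.vertex G w) := by
  obtain ⟨f, β', rfl⟩ := List.exists_cons_of_ne_nil hβ
  by_cases hef : e = f
  · subst hef
    have key : P (.vertex G w) * T e * (((e :: β').map S).prod * P (.vertex G (G.source e))) *
        (S e * P (.vertex G w)) =
          P (.vertex G w) * ((β' ++ [e]).map S).prod * P (.vertex G w) := by
      rw [List.map_cons, List.prod_cons, List.map_append, List.prod_append, List.map_singleton,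
        List.prod_singleton]
      calc _ = P (.vertex G w) * (T e * S e) * (β'.map S).prod *
            (P (.vertex G (G.source e)) * S e) * P (.vertex G w) := by simp only [mul_assoc]
        _ = _ := by
          rw [h.sStar_s_self, h.source_s, h.vertex_mul_p (A := .range G e) hw]
          simp only [mul_assoc]
    rw [key]
    obtain ⟨f, γ, hfγ⟩ := List.exists_cons_of_ne_nil (l := β' ++ [e]) (by simp)
    by_cases hf : G.source f = w
    · refine Or.inr ⟨β', f, γ, rfl, hfγ, hf, ?_⟩
      rw [hfγ, h.p_mul_path γ (by simpa using hf)]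
    · exact Or.inl (by rw [hfγ, h.p_mul_path_of_notMem γ (by simpa using hf), zero_mul])
  · left
    calc _ = P (.vertex G w) * (T e * S f) * ((β'.map S).prod * P (.vertex G (G.source e)) *
          (S e * P (.vertex G w))) := by simp only [List.map_cons, List.prod_cons, mul_assoc]
      _ = 0 := by rw [h.sStar_s_ne e f hef, mul_zero, zero_mul]

section Minimal

variable {x : B} {v : V} {r : R} {L : List (R × List E)}

/-- If the number of terms cannot be lowered, all paths involved are closed paths at `v`. -/
theorem ReducesTo.vertex_mul_ne_zero (h : IsLeavittFamily G P S T) (hx : ReducesTo P S T x v r L)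
    (hmin : ∀ (w : V) (r' : R) L', ReducesTo P S T x w r' L' → L.length ≤ L'.length)
    {q : R × List E} (hq : q ∈ L) :
    P (.vertex G v) * ((q.2.map S).prod * P (.vertex G v)) ≠ 0 := by
  intro h0
  obtain ⟨L', hL', -, hlt⟩ := hx.mul_mul (vertex_mem_wordsOf v) (vertex_mem_wordsOf v)
    (by rw [h.p_mul_self, h.p_mul_self]) (fun q hq => by
      obtain ⟨e, β, hβ⟩ := List.exists_cons_of_ne_nil (hx.2.1 q hq)
      rw [hβ, ← mul_assoc]
      by_cases he : G.source e = v
      · right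
        exact ⟨e :: β, by simp, by
          rw [h.p_mul_path β (by simpa using he), mul_assoc, h.p_mul_self]⟩
      · left
        rw [h.p_mul_path_of_notMem β (by simpa using he), zero_mul, zero_mul])
  exact absurd (hmin v r L' hL') (not_le.2 (hlt ⟨q, hq, by rw [h0, zero_mul]⟩))

/-- If the number of terms cannot be lowered, conjugating by an edge that starts at `v` kills no
term, and the result is again minimal. -/
theorem ReducesTo.conj (h : IsLeavittFamily G P S T) (e : E)
    (hx : ReducesTo P S T x (G.source e) r L)
    (hmin : ∀ (w : V) (r' : R) L', ReducesTo P S T x w r' L' → L.length ≤ L'.length)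
    {w : V} (hw : w ∈ G.range e) :
    (∃ L', ReducesTo P S T x w r L' ∧ L'.length = L.length) ∧
      ∀ q ∈ L, ∃ β f γ, q.2 = e :: β ∧ β ++ [e] = f :: γ ∧ G.source f = w := by
  obtain ⟨L', hL', hle, hlt⟩ := hx.mul_mul (w := w)
    (mul_mem (vertex_mem_wordsOf w) (ghost_mem_wordsOf e))
    (mul_mem (edge_mem_wordsOf e) (vertex_mem_wordsOf w)) (by
      rw [mul_assoc, mul_assoc (P (.vertex G w)), ← mul_assoc (T e), h.sStar_source,
        ← mul_assoc (T e), h.sStar_s_self, ← mul_assoc, h.vertex_mul_p (A := .range G e) hw, h.p_mul_self])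
    (fun q hq => by
      rcases h.conj_path e hw (hx.2.1 q hq) with h0 | ⟨β, f, γ, -, -, -, h0⟩
      · exact Or.inl h0
      · exact Or.inr ⟨β ++ [e], by simp, h0⟩)
  refine ⟨⟨L', hL', le_antisymm hle (hmin w r L' hL')⟩, fun q hq => ?_⟩
  rcases h.conj_path e hw (hx.2.1 q hq) with h0 | ⟨β, f, γ, h1, h2, h3, -⟩
  · exact absurd (hmin w r L' hL') (not_le.2 (hlt ⟨q, hq, h0⟩))
  · exact ⟨β, f, γ, h1, h2, h3⟩

theorem ReducesTo.exists_unique_edge (h : IsLeavittFamily G P S T) (hx : ReducesTo P S T x v r L)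
    (hmin : ∀ (w : V) (r' : R) L', ReducesTo P S T x w r' L' → L.length ≤ L'.length)
    (hL : L ≠ []) :
    ∃ e w, G.source e = v ∧ (∀ e', G.source e' = v → e' = e) ∧ G.range e = {w} ∧
      ∃ L', ReducesTo P S T x w r L' ∧ L'.length = L.length := by
  obtain ⟨q, hq⟩ := List.exists_mem_of_ne_nil L hL
  obtain ⟨e, β, hβ⟩ := List.exists_cons_of_ne_nil (hx.2.1 q hq)
  have he : G.source e = v := by
    by_contra hne
    refine hx.vertex_mul_ne_zero h hmin hq ?_
    rw [hβ, ← mul_assoc, h.p_mul_path_of_notMem β (by simpa using hne), zero_mul]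
  obtain ⟨w, hw⟩ := G.range_nonempty e
  subst he
  obtain ⟨hex, hall⟩ := hx.conj h e hmin hw
  refine ⟨e, w, rfl, fun e' he' => ?_, ?_, hex⟩
  · obtain ⟨w', hw'⟩ := G.range_nonempty e'
    rw [← he'] at hx
    obtain ⟨β', f, γ, h1, -⟩ := (hx.conj h e' hmin hw').2 q hq
    exact (List.cons.inj (h1.symm.trans hβ)).1
  · refine Set.eq_singleton_iff_unique_mem.2 ⟨hw, fun w' hw' => ?_⟩
    obtain ⟨β₁, f₁, γ₁, h1, h2, rfl⟩ := hall q hq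
    obtain ⟨β₂, f₂, γ₂, h3, h4, rfl⟩ := (hx.conj h e hmin hw').2 q hq
    obtain rfl := (List.cons.inj (h1.symm.trans h3)).2
    rw [(List.cons.inj (h2.symm.trans h4)).1]

end Minimal

/-! ### The reduction theorem in a Leavitt family -/

theorem exists_sum_Icc_eq (C : B) (c : ℕ →₀ R) :
    ∃ (k : ℕ) (lam : ℕ → R),
      (c.sum fun i a => a • C ^ (i + 1)) = ∑ i ∈ Finset.Icc 1 k, lam i • C ^ i := by
  refine ⟨c.support.sup id + 1, fun i => c (i - 1), ?_⟩
  rw [Finsupp.sum_of_support_subset c (s := Finset.range (c.support.sup id + 1)) _ _ (by simp)]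
  · rw [Finset.range_eq_Ico,
      show Finset.Icc 1 (c.support.sup id + 1) = Finset.Ico (0 + 1) (c.support.sup id + 1 + 1) by
        ext; simp only [Finset.mem_Icc, Finset.mem_Ico]; omega, ← Finset.sum_Ico_add']
    simp
  · intro i hi
    exact Finset.mem_range.2 (Nat.lt_succ_of_le (Finset.le_sup (f := id) hi))

theorem orbitPath_mul_prod {σ : V → V} (ε : V → E) {v : V} {n : ℕ} (hn : σ^[n] v = v) (m : ℕ) :
    ((orbitPath ε σ (n * m) v).map S).prod = ((orbitPath ε σ n v).map S).prod ^ m := by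
  induction m with
  | zero => simp [orbitPath_zero]
  | succ m ih =>
    rw [Nat.mul_succ, add_comm, orbitPath_add, hn, List.map_append, List.prod_append, ih, pow_succ']

theorem exists_reduction (h : IsLeavittFamily G P S T) (hI : VertexIndependent R P S) {x : B}
    (hx : x ∈ monomialSpan R P S T Set.univ) (hx0 : x ≠ 0) :
    ∃ μ ∈ wordsOf P S T, ∃ ν ∈ wordsOf P S T, μ * x * ν ≠ 0 ∧
      ((∃ (r : R) (A : G.GenVertex), μ * x * ν = r • P A) ∨
        ∃ c : List E, G.IsCycle c ∧ ¬ G.HasExit c ∧ ∃ (k : ℕ) (lam : ℕ → R),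
          μ * x * ν = ∑ i ∈ Finset.Icc 1 k, lam i • (c.map S).prod ^ i) := by
  classical
  have hex : ∃ N, ∃ (v : V) (r : R) (L : List (R × List E)),
      ReducesTo P S T x v r L ∧ L.length = N := by
    obtain ⟨v, r, L, hL⟩ := h.exists_reducesTo hI hx hx0
    exact ⟨_, v, r, L, hL, rfl⟩
  obtain ⟨v, r, L, hvL, hLN⟩ := Nat.find_spec hex
  have hmin : ∀ (w : V) (r' : R) L', ReducesTo P S T x w r' L' → Nat.find hex ≤ L'.length :=
    fun w r' L' hL' => Nat.find_min' hex ⟨w, r', L', hL', rfl⟩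
  obtain ⟨hr, hLne, μ, hμ, ν, hν, heq⟩ := id hvL
  have hne : μ * x * ν ≠ 0 := heq ▸ vertexSum_ne_zero hI hr hLne
  rcases eq_or_ne L [] with rfl | hL
  · exact ⟨μ, hμ, ν, hν, hne, Or.inl ⟨r, .vertex G v, by rw [heq, vertexSum]; simp⟩⟩
  have hN : Nat.find hex ≠ 0 := by
    rw [← hLN]
    exact mt List.length_eq_zero_iff.1 hL
  -- The vertices reached with the least number of terms form a deterministic set.
  set D : Set V := {w | ∃ (r' : R) (L' : List (R × List E)),
    ReducesTo P S T x w r' L' ∧ L'.length = Nat.find hex} with hDdef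
  have step : ∀ w ∈ D, ∃ e w', G.source e = w ∧ (∀ e', G.source e' = w → e' = e) ∧
      G.range e = {w'} ∧ w' ∈ D := by
    rintro w ⟨r', L', hL', hlen⟩
    obtain ⟨e, w', h1, h2, h3, L'', h4, h5⟩ := hL'.exists_unique_edge h
      (fun u t M hM => hlen ▸ hmin u t M hM) (fun h0 => hN (by rw [← hlen, h0]; rfl))
    exact ⟨e, w', h1, h2, h3, r', L'', h4, h5.trans hlen⟩
  have hvD : v ∈ D := ⟨r, L, hvL, hLN⟩
  have : Nonempty V := ⟨v⟩
  have : Nonempty E := ⟨(step v hvD).choose⟩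
  choose! ε σ h1 h2 h3 h4 using step
  have hD : IsDeterministic G D ε σ := ⟨h1, h2, h3, h4⟩
  have hclosed : ∀ q ∈ L, q.2 = orbitPath ε σ q.2.length v ∧ σ^[q.2.length] v = v :=
    fun q hq => hD.eq_orbitPath h hvD q.2
      (hvL.vertex_mul_ne_zero h (fun w r' L' hL' => hLN ▸ hmin w r' L' hL') hq)
  set n := Function.minimalPeriod σ v with hn
  have hn0 : 0 < n := by
    obtain ⟨q, hq⟩ := List.exists_mem_of_ne_nil L hL
    exact Function.IsPeriodicPt.minimalPeriod_pos (List.length_pos_of_ne_nil (hLne q hq))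
      (hclosed q hq).2
  have hσn : σ^[n] v = v := Function.iterate_minimalPeriod
  set c := orbitPath ε σ n v with hc
  set C := (c.map S).prod with hC
  have hcyc : G.IsCycle c := hD.isCycle_orbitPath hvD hn0
  have hcomm : P (.vertex G v) * C = C * P (.vertex G v) := by
    have := hD.vertex_mul_orbitPath h hvD n
    rwa [hσn] at this
  have hPC : P (.vertex G v) * C = C := by
    obtain ⟨m, hm⟩ := Nat.exists_eq_add_of_lt hn0
    rw [hC, hc, hm, zero_add, orbitPath_succ]
    exact h.p_mul_path _ (hD.source_eq v hvD)
  -- Closed paths at `v` are powers of `c`, so the reduced element is a polynomial in `s_c`.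
  obtain ⟨a, ha⟩ : ∃ a : ℕ →₀ R,
      (a.sum fun i t => t • (C ^ i * P (.vertex G v))) = μ * x * ν := by
    rw [← Finsupp.mem_span_range_iff_exists_finsupp, heq, vertexSum]
    refine add_mem (Submodule.smul_mem _ _ (Submodule.subset_span ⟨0, by simp⟩))
      (list_sum_mem fun y hy => ?_)
    obtain ⟨q, hq, rfl⟩ := List.mem_map.1 hy
    obtain ⟨hq1, hq2⟩ := hclosed q hq
    obtain ⟨m, hm⟩ := Function.IsPeriodicPt.minimalPeriod_dvd hq2
    refine Submodule.smul_mem _ _ (Submodule.subset_span ⟨m, ?_⟩)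
    beta_reduce
    rw [hq1, hm, orbitPath_mul_prod ε hσn]
  have hpow (i : ℕ) : P (.vertex G v) * C ^ i = C ^ i * P (.vertex G v) :=
    Commute.pow_right hcomm i
  have hright : μ * x * ν * C = a.sum fun i t => t • C ^ (i + 1) := by
    rw [← ha, Finsupp.sum_mul]
    refine Finset.sum_congr rfl fun i _ => ?_
    beta_reduce
    rw [smul_mul_assoc, mul_assoc, hPC, pow_succ]
  have hleft : C * (μ * x * ν) = a.sum fun i t => t • C ^ (i + 1) := by
    rw [← ha, Finsupp.mul_sum]
    refine Finset.sum_congr rfl fun i _ => ?_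
    beta_reduce
    rw [mul_smul_comm, ← hpow, ← mul_assoc, ← hcomm, hPC, pow_succ']
  have hPy : P (.vertex G v) * (μ * x * ν) = μ * x * ν := by
    rw [← ha, Finsupp.mul_sum]
    refine Finset.sum_congr rfl fun i _ => ?_
    beta_reduce
    rw [mul_smul_comm, ← hpow, ← mul_assoc, h.p_mul_self]
  refine ⟨μ, hμ, ν * C, mul_mem hν (path_mem_wordsOf hcyc.1.1.1), ?_, Or.inr
    ⟨c, hcyc, hD.not_hasExit_orbitPath hvD, ?_⟩⟩
  · intro h0
    rw [← mul_assoc, hright, ← hleft] at h0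
    exact hne (hD.eq_zero_of_orbitPath_mul h hvD n (by rwa [hσn]) h0)
  · rw [← mul_assoc, hright]
    exact exists_sum_Icc_eq C a

end LPA.IsLeavittFamily

/-! ### The Leavitt path algebra -/

section LPA

variable (R : Type w) [CommRing R] (G : Ultragraph V E)

theorem UnitalLPA.isLeavittFamily :
    LPA.IsLeavittFamily G (fun A => UnitalLPA.gen R G (.p A)) (fun e => UnitalLPA.gen R G (.s e))
      (fun e => UnitalLPA.gen R G (.sStar e)) where
  p_empty := congrArg Subtype.val (LPA.isLeavittFamily R G).p_empty
  p_mul A C := congrArg Subtype.val ((LPA.isLeavittFamily R G).p_mul A C)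
  p_union A C := congrArg Subtype.val ((LPA.isLeavittFamily R G).p_union A C)
  source_s e := congrArg Subtype.val ((LPA.isLeavittFamily R G).source_s e)
  s_range e := congrArg Subtype.val ((LPA.isLeavittFamily R G).s_range e)
  range_sStar e := congrArg Subtype.val ((LPA.isLeavittFamily R G).range_sStar e)
  sStar_source e := congrArg Subtype.val ((LPA.isLeavittFamily R G).sStar_source e)
  sStar_s_self e := congrArg Subtype.val ((LPA.isLeavittFamily R G).sStar_s_self e)
  sStar_s_ne e f hef := congrArg Subtype.val ((LPA.isLeavittFamily R G).sStar_s_ne e f hef)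
  sum_source v hfin hne :=
    (congrArg Subtype.val ((LPA.isLeavittFamily R G).sum_source v hfin hne)).trans
      (AddSubmonoidClass.coe_finsetSum _ _)

theorem UnitalLPA.vertexIndependent :
    VertexIndependent R (fun A : G.GenVertex => UnitalLPA.gen R G (.p A))
      (fun e => UnitalLPA.gen R G (.s e)) := by
  classical
  intro v r hr
  obtain ⟨x, hx⟩ := MaxPath.exists_start_eq G v
  -- The value at `(x, 0)` of the image of the indicator function of degree zero.
  let f : G.MaxPath × ℤ → R := fun y => if y.2 = 0 then 1 else 0
  let φ : UnitalLPA R G →ₗ[R] R :=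
    (LinearMap.proj (x, (0 : ℤ))).comp ((LinearMap.applyₗ f).comp (pathRep R G).toLinearMap)
  have hφ (a : UnitalLPA R G) : φ a = pathRep R G a f (x, 0) := rfl
  have hle : pathSpan R (fun A : G.GenVertex => UnitalLPA.gen R G (.p A))
      (fun e => UnitalLPA.gen R G (.s e)) {α | α ≠ []} ≤ LinearMap.ker φ := by
    refine Submodule.span_le.2 ?_
    rintro _ ⟨α, hα, A, rfl⟩
    rw [SetLike.mem_coe, LinearMap.mem_ker, hφ]
    refine pathRep_path_mul_p_apply R G α A f (fun y m hm => if_neg hm) x 0 ?_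
    exact_mod_cast (List.length_pos_of_ne_nil hα).ne
  have h0 : φ (r • UnitalLPA.gen R G (.p (.vertex G v))) = 0 := hle hr
  rw [map_smul, hφ, pathRep_gen, genAction_p, if_pos (by simpa using hx)] at h0
  simpa [f] using h0

theorem LPA.exists_words_coe_eq {μ : UnitalLPA R G}
    (hμ : μ ∈ wordsOf (fun A : G.GenVertex => UnitalLPA.gen R G (.p A))
      (fun e => UnitalLPA.gen R G (.s e)) (fun e => UnitalLPA.gen R G (.sStar e))) :
    ∃ μ' ∈ LPA.words R G, (μ' : UnitalLPA R G) = μ := by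
  induction hμ using Subsemigroup.closure_induction with
  | mem y hy =>
    rcases hy with (⟨e, rfl⟩ | ⟨e, rfl⟩) | ⟨v, rfl⟩
    · exact ⟨_, Subsemigroup.subset_closure (.inl (.inl ⟨e, rfl⟩)), rfl⟩
    · exact ⟨_, Subsemigroup.subset_closure (.inl (.inr ⟨e, rfl⟩)), rfl⟩
    · exact ⟨_, Subsemigroup.subset_closure (.inr ⟨v, rfl⟩), rfl⟩
  | mul y z _ _ hy hz =>
    obtain ⟨y', hy', rfl⟩ := hy
    obtain ⟨z', hz', rfl⟩ := hz
    exact ⟨y' * z', mul_mem hy' hz', rfl⟩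

theorem LPA.coe_mem_monomialSpan (x : LPA R G) :
    (x : UnitalLPA R G) ∈ monomialSpan R (fun A : G.GenVertex => UnitalLPA.gen R G (.p A))
      (fun e => UnitalLPA.gen R G (.s e)) (fun e => UnitalLPA.gen R G (.sStar e)) Set.univ := by
  refine (UnitalLPA.isLeavittFamily R G).adjoin_le_monomialSpan ?_
  refine NonUnitalAlgebra.adjoin_mono ?_ x.2
  rintro _ ⟨A | e | e, rfl⟩
  · exact .inl (.inl ⟨A, rfl⟩)
  · exact .inl (.inr ⟨e, rfl⟩)
  · exact .inr ⟨e, rfl⟩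

end LPA

end Ultragraph

theorem mainTheorem1 {V : Type u} {E : Type v} {R : Type w} [CommRing R] (G : Ultragraph V E)
    (x : Ultragraph.LPA R G) (hx : x ≠ 0) :
    ∃ μ ∈ Ultragraph.LPA.words R G, ∃ ν ∈ Ultragraph.LPA.words R G,
      μ * x * ν ≠ 0 ∧
      ((∃ (lam : R) (A : G.GenVertex), μ * x * ν = lam • Ultragraph.LPA.p R G A) ∨
        ∃ c : List E, G.IsCycle c ∧ ¬ G.HasExit c ∧
          ∃ (k : ℕ) (lam : ℕ → R),
            ((μ * x * ν : Ultragraph.LPA R G) : Ultragraph.UnitalLPA R G) =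
              ∑ i ∈ Finset.Icc 1 k, lam i • Ultragraph.UnitalLPA.path R G c ^ i) := by
  obtain ⟨μ, hμ, ν, hν, hne, hred⟩ :=
    (Ultragraph.UnitalLPA.isLeavittFamily R G).exists_reduction
      (Ultragraph.UnitalLPA.vertexIndependent R G) (Ultragraph.LPA.coe_mem_monomialSpan R G x)
      (fun h => hx (Subtype.ext h))
  obtain ⟨μ, hμ', rfl⟩ := Ultragraph.LPA.exists_words_coe_eq R G hμ
  obtain ⟨ν, hν', rfl⟩ := Ultragraph.LPA.exists_words_coe_eq R G hν
  refine ⟨μ, hμ', ν, hν', fun h => hne (congrArg Subtype.val h), hred.imp ?_ id⟩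
  rintro ⟨r, A, h⟩
  exact ⟨r, A, Subtype.ext h⟩
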